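/- For a finite simple undirected graph $G=(V,E)$, the domatic number $\delta(G)$ is the largest $k$ such that $V$ can be partitioned into $k$ dominating sets of $G$, where $D\subseteq V$ is dominating if every vertex of $G$ belongs to $D$ or has a neighbour in $D$. The three domatic number problem asks, given $G$, whether $\delta(G)\ge 3$. For functions $f,g$ of $n$ write $f\in\tilde{\mathcal O}(g)$ if $f\in\mathcal O(p\cdot g)$ for some polynomial $p$. For every constant $c>0$ there is a randomized algorithm (a probabilistic random access machine program with logarithmic cost that receives the adjacency matrix of $G$) such that for every integer $\Delta\ge 3$ the following holds. On every graph $G$ with $n$ vertices and maximum degree $\Delta$, the algorithm answers the question whether $\delta(G)\ge 3$ with error probability at most $e^{-c}$, and for all outcomes of its random bits it halts within time $T_\Delta(n)$, where $$T_\Delta(n)\in\tilde{\mathcal O}\bigl(r^{n/2}\bigr),\qquad r=\frac{d}{3^{\Delta-2}},\qquad d=\sum_{a=0}^{\Delta-2}\left[\binom{\Delta}{a}\sum_{b=1}^{\Delta-a-1}\binom{\Delta-a}{b}\right].$$ -/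

import Mathlib

namespace Domatic

/-! ### Domatic partitions -/

section Graphs

variable {V : Type*}

/-- The closed neighbourhood `N[v] = N(v) ∪ {v}`. -/
def closedNeighborSet (G : SimpleGraph V) (v : V) : Set V :=
  G.neighborSet v ∪ {v}

/-- `D` is a dominating set: `N[D] = V`. -/
def IsDominating (G : SimpleGraph V) (D : Set V) : Prop :=
  ⋃ v ∈ D, closedNeighborSet G v = Set.univ

/-- `V` is the disjoint union of `k` dominating sets `V_1, …, V_k`. -/
def HasDomaticPartition (G : SimpleGraph V) (k : ℕ) : Prop :=
  ∃ P : Fin k → Set V, ⋃ i, P i = Set.univ ∧ Pairwise (fun i j => Disjoint (P i) (P j)) ∧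
    ∀ i, IsDominating G (P i)

/-- The domatic number `δ(G)`: the largest `k` such that `V` can be partitioned into `k`
dominating sets (a supremum in `ℕ∞`, attained on every finite nonempty graph). -/
noncomputable def domaticNumber (G : SimpleGraph V) : ℕ∞ :=
  ⨆ (k : ℕ) (_ : HasDomaticPartition G k), (k : ℕ∞)

end Graphs

/-! ### Probabilistic random access machines with logarithmic cost -/

/-- Arithmetic operations on natural numbers (`sub` is truncated, `div` rounds down and gives `0`
for divisor `0`). -/
inductive Op
  | add
  | sub
  | mul
  | div

/-- The value computed by an arithmetic operation. -/
def Op.apply : Op → ℕ → ℕ → ℕ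
  | .add, x, y => x + y
  | .sub, x, y => x - y
  | .mul, x, y => x * y
  | .div, x, y => x / y

/-- Programs of a random access machine with registers `reg 0, reg 1, …`, whose indices are fixed
in the program text (so that each program uses finitely many of them), and an indirectly
addressed memory `mem 0, mem 1, …`; both hold natural numbers. -/
inductive Prog
  /-- `reg d := k` -/
  | const (d k : ℕ)
  /-- `reg d := reg a ∘ reg b` -/
  | arith (d : ℕ) (o : Op) (a b : ℕ)
  /-- `reg d := mem (reg a)` -/
  | load (d a : ℕ)
  /-- `mem (reg a) := reg b` -/
  | store (a b : ℕ)
  /-- `reg d :=` a fresh fair random bit -/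
  | flip (d : ℕ)
  /-- sequential composition -/
  | seq (p q : Prog)
  /-- `if reg a ≠ 0 then p else q` -/
  | ite (a : ℕ) (p q : Prog)
  /-- `while reg a ≠ 0 do p` -/
  | loop (a : ℕ) (p : Prog)

/-- A state of the machine: registers, memory and the number of random bits used so far. -/
structure State where
  reg : ℕ → ℕ
  mem : ℕ → ℕ
  used : ℕ

/-- The state with register `d` overwritten by `x`. -/
def State.setReg (s : State) (d x : ℕ) : State :=
  { s with reg := Function.update s.reg d x }

/-- The state with memory cell `a` overwritten by `x`. -/
def State.setMem (s : State) (a x : ℕ) : State :=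
  { s with mem := Function.update s.mem a x }

/-- `Exec ω p s s' t`: with `ω 0, ω 1, …` as the sequence of random bits, program `p` started in
state `s` halts in state `s'` after time `t`. Time is the logarithmic cost: every instruction and
every test costs `1` plus the binary lengths of the numbers and addresses that it handles. -/
inductive Exec (ω : ℕ → Bool) : Prog → State → State → ℕ → Prop
  | const (d k : ℕ) (s : State) :
      Exec ω (.const d k) s (s.setReg d k) (1 + k.size)
  | arith (d : ℕ) (o : Op) (a b : ℕ) (s : State) :
      Exec ω (.arith d o a b) s (s.setReg d (o.apply (s.reg a) (s.reg b)))
        (1 + (s.reg a).size + (s.reg b).size)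
  | load (d a : ℕ) (s : State) :
      Exec ω (.load d a) s (s.setReg d (s.mem (s.reg a)))
        (1 + (s.reg a).size + (s.mem (s.reg a)).size)
  | store (a b : ℕ) (s : State) :
      Exec ω (.store a b) s (s.setMem (s.reg a) (s.reg b))
        (1 + (s.reg a).size + (s.reg b).size)
  | flip (d : ℕ) (s : State) :
      Exec ω (.flip d) s { s.setReg d (ω s.used).toNat with used := s.used + 1 } 1
  | seq {p q : Prog} {s₁ s₂ s₃ : State} {t₁ t₂ : ℕ} :
      Exec ω p s₁ s₂ t₁ → Exec ω q s₂ s₃ t₂ → Exec ω (.seq p q) s₁ s₃ (t₁ + t₂)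
  | ite_true {a : ℕ} {p q : Prog} {s s' : State} {t : ℕ} :
      s.reg a ≠ 0 → Exec ω p s s' t → Exec ω (.ite a p q) s s' (1 + (s.reg a).size + t)
  | ite_false {a : ℕ} {p q : Prog} {s s' : State} {t : ℕ} :
      s.reg a = 0 → Exec ω q s s' t → Exec ω (.ite a p q) s s' (1 + (s.reg a).size + t)
  | loop_exit {a : ℕ} {p : Prog} {s : State} :
      s.reg a = 0 → Exec ω (.loop a p) s s (1 + (s.reg a).size)
  | loop_step {a : ℕ} {p : Prog} {s₁ s₂ s₃ : State} {t₁ t₂ : ℕ} :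
      s₁.reg a ≠ 0 → Exec ω p s₁ s₂ t₁ → Exec ω (.loop a p) s₂ s₃ t₂ →
      Exec ω (.loop a p) s₁ s₃ (1 + (s₁.reg a).size + t₁ + t₂)

/-- Final state and running time are determined by the program, the initial state and the random
bits. -/
theorem Exec.unique {ω : ℕ → Bool} {p : Prog} {s s₁ s₂ : State} {t₁ t₂ : ℕ}
    (h₁ : Exec ω p s s₁ t₁) (h₂ : Exec ω p s s₂ t₂) : s₁ = s₂ ∧ t₁ = t₂ := by
  induction h₁ generalizing s₂ t₂ with
  | const | arith | load | store | flip => cases h₂; exact ⟨rfl, rfl⟩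
  | seq _ _ ih₁ ih₂ =>
    cases h₂ with
    | seq h h' =>
      obtain ⟨rfl, rfl⟩ := ih₁ h
      obtain ⟨rfl, rfl⟩ := ih₂ h'
      exact ⟨rfl, rfl⟩
  | ite_true hn _ ih =>
    cases h₂ with
    | ite_true _ h => obtain ⟨rfl, rfl⟩ := ih h; exact ⟨rfl, rfl⟩
    | ite_false hz _ => exact absurd hz hn
  | ite_false hz _ ih =>
    cases h₂ with
    | ite_true hn _ => exact absurd hz hn
    | ite_false _ h => obtain ⟨rfl, rfl⟩ := ih h; exact ⟨rfl, rfl⟩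
  | loop_exit hz =>
    cases h₂ with
    | loop_exit _ => exact ⟨rfl, rfl⟩
    | loop_step hn _ _ => exact absurd hz hn
  | loop_step hn _ _ ih₁ ih₂ =>
    cases h₂ with
    | loop_exit hz => exact absurd hz hn
    | loop_step _ h h' =>
      obtain ⟨rfl, rfl⟩ := ih₁ h
      obtain ⟨rfl, rfl⟩ := ih₂ h'
      exact ⟨rfl, rfl⟩

open Classical in
/-- The initial state on input `G`: register `0` holds the number `n` of vertices, memory cell
`i * n + j` holds the entry `(i, j)` of the adjacency matrix (`0 ≤ i, j < n`), and everything else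
is `0`. -/
noncomputable def input {n : ℕ} (G : SimpleGraph (Fin n)) : State where
  reg := fun k => if k = 0 then n else 0
  mem := fun k => if ∃ i j : Fin n, k = i * n + j ∧ G.Adj i j then 1 else 0
  used := 0

/-- With random bits `ω`, program `A` halts on input `G` within time `T`. -/
def HaltsWithin (A : Prog) {n : ℕ} (G : SimpleGraph (Fin n)) (ω : ℕ → Bool) (T : ℝ) : Prop :=
  ∃ (s : State) (t : ℕ), Exec ω A (input G) s t ∧ (t : ℝ) ≤ T

/-- With random bits `ω`, program `A` halts on input `G` and answers yes (register `0` is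
nonzero). -/
def Accepts (A : Prog) {n : ℕ} (G : SimpleGraph (Fin n)) (ω : ℕ → Bool) : Prop :=
  ∃ (s : State) (t : ℕ), Exec ω A (input G) s t ∧ s.reg 0 ≠ 0

/-- The distribution of an infinite sequence of independent fair random bits. -/
noncomputable def coins : MeasureTheory.Measure (ℕ → Bool) :=
  MeasureTheory.Measure.infinitePi fun _ : ℕ => (PMF.uniformOfFintype Bool).toMeasure

/-- The probability that the answer of `A` to the question whether `δ(G) ≥ 3` is wrong. -/
noncomputable def errorProb (A : Prog) {n : ℕ} (G : SimpleGraph (Fin n)) : ENNReal :=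
  coins {ω | ¬ (Accepts A G ω ↔ 3 ≤ domaticNumber G)}

/-! ### The time bound -/

/-- `f ∈ Õ(g)`: `f ∈ O(p · g)` for some polynomial `p`. -/
def SoftO (f g : ℕ → ℝ) : Prop :=
  ∃ p : Polynomial ℝ, f =O[Filter.atTop] fun n => p.eval (n : ℝ) * g n

/-- `d = ∑_{a=0}^{Δ-2} [ C(Δ, a) ∑_{b=1}^{Δ-a-1} C(Δ-a, b) ]`. -/
def dConst (Δ : ℕ) : ℕ :=
  ∑ a ∈ Finset.Icc 0 (Δ - 2), Δ.choose a * ∑ b ∈ Finset.Icc 1 (Δ - a - 1), (Δ - a).choose b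

/-- `r = d / 3^(Δ-2)`. -/
noncomputable def rConst (Δ : ℕ) : ℝ :=
  (dConst Δ : ℝ) / 3 ^ (Δ - 2)

end Domatic

namespace Domatic

/-! The bound is weak enough for a deterministic algorithm that works on every graph. The binomial
theorem gives $d = 3^\Delta - 2\cdot 2^\Delta + 1$, so $r \ge 4$ for all $\Delta \ge 3$, with
equality at $\Delta = 3$ (`dConst_add`, `four_le_rConst`). Hence $r^{n/2} \ge 2^n$, and it suffices
to decide $\delta(G) \ge 3$ in time $2^n$ times a polynomial, without random bits and hence without
error.

This is done by inclusion-exclusion over vertex sets. Put $W = 16^n$ and give each dominating set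
$D$ the weight $W^{|D|}$. Summing over subsets (zeta transform), cubing and inverting (Moebius
transform) leaves at $V$ the sum of $W^{|D_1|+|D_2|+|D_3|}$ over the triples of dominating sets with
union $V$. Covering forces the exponent to be at least $n$, with equality exactly for partitions.
There are at most $8^n < W$ triples, so the base-$W$ digit at position $n$ counts the ordered
partitions without carry (`moebiusFrom_digit`). The transforms process one vertex at a time
(`zetaFrom_of_mem`, `moebiusFrom_of_mem`).

All numbers stay below $2^{16n^2}$, so under logarithmic cost each instruction costs $O(n^2)$.
`Reaches` therefore counts instructions and maintains this bound, and loop invariants give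
correctness (`threeDomatic_spec`). -/

@[simp] theorem State.setReg_reg (s : State) (d x k : ℕ) :
    (s.setReg d x).reg k = if k = d then x else s.reg k := by
  simp [State.setReg, Function.update_apply]

@[simp] theorem State.setReg_mem (s : State) (d x : ℕ) : (s.setReg d x).mem = s.mem := rfl

@[simp] theorem State.setMem_reg (s : State) (a x : ℕ) : (s.setMem a x).reg = s.reg := rfl

@[simp] theorem State.setMem_mem (s : State) (a x k : ℕ) :
    (s.setMem a x).mem k = if k = a then x else s.mem k := by
  simp [State.setMem, Function.update_apply]

/-! ### Program logic: instruction counts under a uniform bound on all numbers. -/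

/-- All numbers stored in the state are at most `M`. -/
structure State.Bounded (M : ℕ) (s : State) : Prop where
  reg : ∀ k, s.reg k ≤ M
  mem : ∀ k, s.mem k ≤ M

theorem State.Bounded.setReg {M : ℕ} {s : State} (h : s.Bounded M) (d : ℕ) {x : ℕ} (hx : x ≤ M) :
    (s.setReg d x).Bounded M := by
  refine ⟨fun k => ?_, h.mem⟩
  rw [State.setReg_reg]
  split_ifs
  exacts [hx, h.reg k]

theorem State.Bounded.setMem {M : ℕ} {s : State} (h : s.Bounded M) (a : ℕ) {x : ℕ} (hx : x ≤ M) :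
    (s.setMem a x).Bounded M := by
  refine ⟨h.reg, fun k => ?_⟩
  rw [State.setMem_mem]
  split_ifs
  exacts [hx, h.mem k]

/-- Started in `s` with all numbers at most `M`, the program `p` halts after at most `N`
instructions and tests, in a state that satisfies `Q`, and all numbers stay at most `M`. -/
def Reaches (ω : ℕ → Bool) (M : ℕ) (p : Prog) (s : State) (N : ℕ) (Q : State → Prop) : Prop :=
  s.Bounded M → ∃ s' t, Exec ω p s s' t ∧ t ≤ N * (1 + 2 * M.size) ∧ s'.Bounded M ∧ Q s'

section Rules

variable {ω : ℕ → Bool} {M N : ℕ} {s : State} {Q : State → Prop}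

theorem Reaches.mono {p : Prog} {N' : ℕ} {Q' : State → Prop} (h : Reaches ω M p s N Q)
    (hN : N ≤ N') (hQ : ∀ s', Q s' → Q' s') : Reaches ω M p s N' Q' := by
  intro hs
  obtain ⟨s', t, he, ht, hb, hq⟩ := h hs
  exact ⟨s', t, he, ht.trans (Nat.mul_le_mul_right _ hN), hb, hQ _ hq⟩

theorem reaches_const {d k : ℕ} (hk : k ≤ M) (hQ : Q (s.setReg d k)) :
    Reaches ω M (.const d k) s 1 Q := by
  intro hs
  refine ⟨_, _, .const d k s, ?_, hs.setReg d hk, hQ⟩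
  have := Nat.size_le_size hk
  lia

theorem reaches_arith {d a b : ℕ} {o : Op} (ho : o.apply (s.reg a) (s.reg b) ≤ M)
    (hQ : Q (s.setReg d (o.apply (s.reg a) (s.reg b)))) :
    Reaches ω M (.arith d o a b) s 1 Q := by
  intro hs
  refine ⟨_, _, .arith d o a b s, ?_, hs.setReg d ho, hQ⟩
  have := Nat.size_le_size (hs.reg a)
  have := Nat.size_le_size (hs.reg b)
  lia

theorem reaches_load {d a : ℕ} (hQ : Q (s.setReg d (s.mem (s.reg a)))) :
    Reaches ω M (.load d a) s 1 Q := by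
  intro hs
  refine ⟨_, _, .load d a s, ?_, hs.setReg d (hs.mem _), hQ⟩
  have := Nat.size_le_size (hs.reg a)
  have := Nat.size_le_size (hs.mem (s.reg a))
  lia

theorem reaches_store {a b : ℕ} (hQ : Q (s.setMem (s.reg a) (s.reg b))) :
    Reaches ω M (.store a b) s 1 Q := by
  intro hs
  refine ⟨_, _, .store a b s, ?_, hs.setMem _ (hs.reg b), hQ⟩
  have := Nat.size_le_size (hs.reg a)
  have := Nat.size_le_size (hs.reg b)
  lia

theorem Reaches.seq {p q : Prog} {N₁ N₂ : ℕ}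
    (h : Reaches ω M p s N₁ fun s' => Reaches ω M q s' N₂ Q) :
    Reaches ω M (.seq p q) s (N₁ + N₂) Q := by
  intro hs
  obtain ⟨s₁, t₁, he₁, ht₁, hb₁, h₁⟩ := h hs
  obtain ⟨s₂, t₂, he₂, ht₂, hb₂, h₂⟩ := h₁ hb₁
  refine ⟨s₂, _, .seq he₁ he₂, ?_, hb₂, h₂⟩
  rw [add_mul]
  lia

theorem reaches_ite {a : ℕ} {p q : Prog} (hp : s.reg a ≠ 0 → Reaches ω M p s N Q)
    (hq : s.reg a = 0 → Reaches ω M q s N Q) : Reaches ω M (.ite a p q) s (N + 1) Q := by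
  intro hs
  have := Nat.size_le_size (hs.reg a)
  by_cases h0 : s.reg a = 0
  · obtain ⟨s', t, he, ht, hb, h⟩ := hq h0 hs
    refine ⟨s', _, .ite_false h0 he, ?_, hb, h⟩
    rw [add_mul]
    lia
  · obtain ⟨s', t, he, ht, hb, h⟩ := hp h0 hs
    refine ⟨s', _, .ite_true h0 he, ?_, hb, h⟩
    rw [add_mul]
    lia

/-- The invariant is indexed by the value of the loop register, which each round lowers by one, so a
single induction gives termination, correctness and the count of `k` bodies and `k + 1` tests. -/
theorem reaches_loop {a : ℕ} {p : Prog} (I : ℕ → State → Prop)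
    (hI : ∀ k s, I k s → s.reg a = k)
    (hp : ∀ k s, I (k + 1) s → Reaches ω M p s N (I k)) (k : ℕ) (hk : I k s)
    (hQ : ∀ s', I 0 s' → Q s') :
    Reaches ω M (.loop a p) s (k * (N + 1) + 1) Q := by
  induction k generalizing s with
  | zero =>
    intro hs
    have := Nat.size_le_size (hs.reg a)
    refine ⟨s, _, .loop_exit (hI 0 s hk), ?_, hs, hQ s hk⟩
    lia
  | succ k ih =>
    intro hs
    have := Nat.size_le_size (hs.reg a)
    obtain ⟨s₁, t₁, he₁, ht₁, hb₁, h₁⟩ := hp k s hk hs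
    obtain ⟨s₂, t₂, he₂, ht₂, hb₂, h₂⟩ := ih h₁ hb₁
    refine ⟨s₂, _, .loop_step (by rw [hI _ _ hk]; exact k.succ_ne_zero) he₁ he₂, ?_, hb₂, h₂⟩
    calc _ ≤ (1 + 2 * M.size) + N * (1 + 2 * M.size) +
          (k * (N + 1) + 1) * (1 + 2 * M.size) := by lia
      _ = _ := by ring

/-- Sequential composition of a list of programs. -/
def block : List Prog → Prog
  | [] => .const 16 0
  | p :: l => .seq p (block l)

theorem reaches_block_nil (hQ : Q (s.setReg 16 0)) : Reaches ω M (block []) s 1 Q :=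
  reaches_const (Nat.zero_le _) hQ

theorem reaches_block_cons {p : Prog} {l : List Prog} {N₁ N₂ : ℕ}
    (h : Reaches ω M p s N₁ fun s' => Reaches ω M (block l) s' N₂ Q) :
    Reaches ω M (block (p :: l)) s (N₁ + N₂) Q :=
  Reaches.seq h

theorem reaches_block_const {l : List Prog} {d k : ℕ} (hk : k ≤ M)
    (h : Reaches ω M (block l) (s.setReg d k) N Q) :
    Reaches ω M (block (.const d k :: l)) s (N + 1) Q := by
  rw [add_comm]
  exact reaches_block_cons (reaches_const hk h)

theorem reaches_block_arith {l : List Prog} {d a b : ℕ} {o : Op}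
    (ho : o.apply (s.reg a) (s.reg b) ≤ M)
    (h : Reaches ω M (block l) (s.setReg d (o.apply (s.reg a) (s.reg b))) N Q) :
    Reaches ω M (block (.arith d o a b :: l)) s (N + 1) Q := by
  rw [add_comm]
  exact reaches_block_cons (reaches_arith ho h)

theorem reaches_block_add {l : List Prog} {d a b : ℕ} (ho : s.reg a + s.reg b ≤ M)
    (h : Reaches ω M (block l) (s.setReg d (s.reg a + s.reg b)) N Q) :
    Reaches ω M (block (.arith d .add a b :: l)) s (N + 1) Q :=
  reaches_block_arith ho h

theorem reaches_block_mul {l : List Prog} {d a b : ℕ} (ho : s.reg a * s.reg b ≤ M)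
    (h : Reaches ω M (block l) (s.setReg d (s.reg a * s.reg b)) N Q) :
    Reaches ω M (block (.arith d .mul a b :: l)) s (N + 1) Q :=
  reaches_block_arith ho h

/-- Truncated subtraction never exceeds its first operand, so the bound is inherited from the state
and needs no side condition, unlike for sums and products. -/
theorem reaches_block_sub {l : List Prog} {d a b : ℕ}
    (h : Reaches ω M (block l) (s.setReg d (s.reg a - s.reg b)) N Q) :
    Reaches ω M (block (.arith d .sub a b :: l)) s (N + 1) Q :=
  fun hs => reaches_block_arith ((Nat.sub_le _ _).trans (hs.reg a)) h hs

theorem reaches_block_div {l : List Prog} {d a b : ℕ}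
    (h : Reaches ω M (block l) (s.setReg d (s.reg a / s.reg b)) N Q) :
    Reaches ω M (block (.arith d .div a b :: l)) s (N + 1) Q :=
  fun hs => reaches_block_arith ((Nat.div_le_self _ _).trans (hs.reg a)) h hs

theorem reaches_block_load {l : List Prog} {d a : ℕ}
    (h : Reaches ω M (block l) (s.setReg d (s.mem (s.reg a))) N Q) :
    Reaches ω M (block (.load d a :: l)) s (N + 1) Q := by
  rw [add_comm]
  exact reaches_block_cons (reaches_load h)

theorem reaches_block_store {l : List Prog} {a b : ℕ}
    (h : Reaches ω M (block l) (s.setMem (s.reg a) (s.reg b)) N Q) :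
    Reaches ω M (block (.store a b :: l)) s (N + 1) Q := by
  rw [add_comm]
  exact reaches_block_cons (reaches_store h)

theorem reaches_block_ite {l : List Prog} {a : ℕ} {p q : Prog} (N' : ℕ)
    (hp : s.reg a ≠ 0 → Reaches ω M p s N' fun s' => Reaches ω M (block l) s' N Q)
    (hq : s.reg a = 0 → Reaches ω M q s N' fun s' => Reaches ω M (block l) s' N Q) :
    Reaches ω M (block (.ite a p q :: l)) s (N + (N' + 1)) Q := by
  rw [add_comm]
  exact reaches_block_cons (reaches_ite hp hq)

theorem reaches_block_loop {l : List Prog} {a : ℕ} {p : Prog} {N' : ℕ} (I : ℕ → State → Prop)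
    (hI : ∀ k s, I k s → s.reg a = k)
    (hp : ∀ k s, I (k + 1) s → Reaches ω M p s N' (I k)) {k : ℕ} (hk : I k s)
    (hQ : ∀ s', I 0 s' → Reaches ω M (block l) s' N Q) :
    Reaches ω M (block (.loop a p :: l)) s (k * (N' + 1) + (N + 1)) Q := by
  rw [add_comm N, ← add_assoc]
  exact reaches_block_cons (reaches_loop I hI hp k hk hQ)

end Rules


/-! ### The inclusion-exclusion program. -/

section Programs

/-- `for reg a := reg a - 1 down to 0 do l`. -/
def forDown (a : ℕ) (l : List Prog) : Prog :=
  .loop a (block (.arith a .sub a 1 :: l))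

/-- `reg 13 :=` the bit of `reg 6` at the position with weight `reg 9`, followed by `l`. -/
def bitThen (l : List Prog) : List Prog :=
  .arith 13 .div 6 9 :: .arith 14 .div 13 2 :: .arith 14 .mul 14 2 :: .arith 13 .sub 13 14 :: l

/-- Compute `1`, `2`, `2 ^ n`, `16 ^ n`, `n * n` in registers `1` to `5`. -/
def initRegs : Prog :=
  block [.const 1 1, .const 2 2, .const 3 1, .const 4 1, .const 13 16, .arith 5 .mul 0 0,
    .arith 6 .div 0 1, forDown 6 [.arith 3 .mul 3 2, .arith 4 .mul 4 13]]

/-- Put ones on the diagonal of the adjacency matrix. -/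
def setDiag : Prog :=
  block [.arith 6 .div 0 1, forDown 6 [.arith 13 .mul 6 0, .arith 13 .add 13 6, .store 13 1]]

/-- With the vertex set coded by `reg 6`: multiply `reg 10` by `16 ^ n` for each of its elements and
set `reg 12` if it meets the closed neighbourhood of the vertex `reg 7`. -/
def scanSet : Prog :=
  block [.const 12 0, .const 10 1, .arith 8 .div 0 1, .arith 9 .div 3 1,
    forDown 8 (.arith 9 .div 9 2 :: bitThen [.ite 13
      (block [.arith 10 .mul 10 4, .arith 14 .mul 7 0, .arith 14 .add 14 8, .load 14 14,
        .ite 14 (.const 12 1) (.const 14 0)])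
      (.const 14 0)])]

/-- Clear `reg 11` if the set coded by `reg 6` is not dominating. -/
def testDominating : Prog :=
  block [.const 11 1, .arith 7 .div 0 1,
    forDown 7 [scanSet, .ite 12 (.const 14 0) (.const 11 0)]]

/-- Fill the table of weighted dominating sets. -/
def fillTable : Prog :=
  block [.arith 6 .div 3 1, forDown 6 [testDominating, .arith 13 .add 5 6, .arith 10 .mul 10 11,
    .store 13 10]]

/-- The transform `A[X] := A[X] ∘ A[X - 2 ^ j]` for all positions `j` and all `X` with bit `j`. -/
def transform (o : Op) : Prog :=
  block [.arith 7 .div 0 1, .arith 9 .div 3 1,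
    forDown 7 [.arith 9 .div 9 2, block [.arith 6 .div 3 1,
      forDown 6 (bitThen [.ite 13
        (block [.arith 14 .add 5 6, .arith 15 .sub 14 9, .load 10 15, .load 11 14,
          .arith 11 o 11 10, .store 14 11])
        (.const 14 0)])]]]

/-- Replace all entries of the table by their cubes. -/
def cubeTable : Prog :=
  block [.arith 6 .div 3 1, forDown 6 [.arith 14 .add 5 6, .load 10 14, .arith 11 .mul 10 10,
    .arith 11 .mul 11 10, .store 14 11]]

/-- Extract the digit number `n` to base `16 ^ n` of the last entry of the table. -/
def extract : Prog :=
  block [.const 10 1, .arith 6 .div 0 1, forDown 6 [.arith 10 .mul 10 4],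
    .arith 13 .add 5 3, .arith 13 .sub 13 1, .load 14 13, .arith 14 .div 14 10,
    .arith 15 .div 14 4, .arith 15 .mul 15 4, .arith 0 .sub 14 15]

/-- Decide whether `δ(G) ≥ 3` without random bits, by inclusion-exclusion: the zeta transform of
the weights `(16 ^ n) ^ |D|` of the dominating sets `D` is cubed and transformed back, which leaves
at `V` the sum of the weights of the triples of dominating sets that cover `V`; its digit number `n`
to base `16 ^ n` counts the partitions. Every number has `O(n ^ 2)` bits. -/
def threeDomatic : Prog :=
  block [initRegs, setDiag, fillTable, transform .add, cubeTable, transform .sub, extract]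

end Programs

/-! ### Specifications of the subprograms. -/

/-- The contents of the registers that hold constants. -/
structure Env (n : ℕ) (s : State) : Prop where
  r0 : s.reg 0 = n
  r1 : s.reg 1 = 1
  r2 : s.reg 2 = 2
  r3 : s.reg 3 = 2 ^ n
  r4 : s.reg 4 = 16 ^ n
  r5 : s.reg 5 = n * n

@[simp] theorem env_setReg {n d : ℕ} {s : State} (hd : 5 < d) (x : ℕ) :
    Env n (s.setReg d x) ↔ Env n s := by
  have h : ∀ k, k ≤ 5 → (s.setReg d x).reg k = s.reg k := fun k hk => by
    rw [State.setReg_reg, if_neg (by lia)]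
  constructor
  · rintro ⟨h0, h1, h2, h3, h4, h5⟩
    constructor <;> rw [← h] <;> first | assumption | lia
  · rintro ⟨h0, h1, h2, h3, h4, h5⟩
    constructor <;> rw [h] <;> first | assumption | lia

@[simp] theorem env_setMem {n : ℕ} {s : State} (a x : ℕ) : Env n (s.setMem a x) ↔ Env n s :=
  ⟨fun h => ⟨h.r0, h.r1, h.r2, h.r3, h.r4, h.r5⟩, fun h => ⟨h.r0, h.r1, h.r2, h.r3, h.r4, h.r5⟩⟩

/-- The machine has no remainder operation; the parity of `q = X / 2 ^ j` is computed as `q - q / 2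
* 2`. -/
theorem testBit_iff_sub_ne_zero (X j : ℕ) :
    X / 2 ^ j - X / 2 ^ j / 2 * 2 ≠ 0 ↔ X.testBit j = true := by
  rw [Nat.testBit_eq_decide_div_mod_eq, decide_eq_true_iff]
  lia

section Specs

variable {ω : ℕ → Bool} {M N n : ℕ} {s : State} {Q : State → Prop}

theorem reaches_bitThen {l : List Prog} {X j : ℕ} (hE : Env n s) (h6 : s.reg 6 = X)
    (h9 : s.reg 9 = 2 ^ j) (hM : X ≤ M)
    (h : ∀ s', Env n s' → s'.mem = s.mem → (∀ k, k ≠ 13 → k ≠ 14 → s'.reg k = s.reg k) →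
      (s'.reg 13 ≠ 0 ↔ X.testBit j = true) → Reaches ω M (block l) s' N Q) :
    Reaches ω M (block (bitThen l)) s (N + 4) Q := by
  refine reaches_block_div (reaches_block_div (reaches_block_mul ?_ (reaches_block_sub
    (h _ ?_ ?_ ?_ ?_))))
  · simp only [State.setReg_reg, h6, h9, hE.r2]
    simp only [↓reduceIte, Nat.reduceEqDiff]
    exact ((Nat.div_mul_le_self _ _).trans (Nat.div_le_self _ _)).trans hM
  · simpa using hE
  · simp
  · intro k h13 h14
    simp [h13, h14]
  · rw [← testBit_iff_sub_ne_zero]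
    simp [h6, h9, hE.r2]

/-- The first `n * n` memory cells hold the matrix of the relation `C`. -/
def StoresRel (n : ℕ) (C : ℕ → ℕ → Prop) (s : State) : Prop :=
  ∀ v < n, ∀ u < n, s.mem (v * n + u) ≠ 0 ↔ C v u

/-- The next `2 ^ n` memory cells hold the table `g`. -/
def StoresTable (n : ℕ) (g : ℕ → ℕ) (s : State) : Prop :=
  ∀ X < 2 ^ n, s.mem (n * n + X) = g X

theorem initRegs_spec (h0 : s.reg 0 = n) (hn : 0 < n) (h2 : 2 ^ n ≤ M) (h16 : 16 ^ n ≤ M)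
    (hn2 : n * n ≤ M)
    (hQ : ∀ s', Env n s' → s'.mem = s.mem → Q s') :
    Reaches ω M initRegs s (n * 5 + 9) Q := by
  -- The program loads the constant 16, which is bounded by `16 ^ n` only for positive `n`.
  have h16' : 16 ≤ M := le_trans (by simpa using Nat.pow_le_pow_right (n := 16) (by simp) hn) h16
  refine reaches_block_const (by lia) (reaches_block_const (by lia) (reaches_block_const (by lia)
    (reaches_block_const (by lia) (reaches_block_const (by lia) (reaches_block_mul ?_
    (reaches_block_div ?_))))))
  · simpa [h0] using hn2
  refine reaches_block_loop (fun k s' => k ≤ n ∧ s'.reg 0 = n ∧ s'.reg 1 = 1 ∧ s'.reg 2 = 2 ∧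
    s'.reg 3 = 2 ^ (n - k) ∧ s'.reg 4 = 16 ^ (n - k) ∧ s'.reg 5 = n * n ∧ s'.reg 6 = k ∧
    s'.reg 13 = 16 ∧ s'.mem = s.mem) (by tauto) ?_ ?_ ?_
  · rintro k s' ⟨hk, a0, a1, a2, a3, a4, a5, a6, a13, am⟩
    have e : n - k = n - (k + 1) + 1 := by lia
    have l2 : 2 ^ (n - (k + 1)) * 2 ≤ M := by
      rw [← pow_succ, ← e]
      exact (Nat.pow_le_pow_right (by simp) (by lia)).trans h2
    have l16 : 16 ^ (n - (k + 1)) * 16 ≤ M := by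
      rw [← pow_succ, ← e]
      exact (Nat.pow_le_pow_right (by simp) (by lia)).trans h16
    refine reaches_block_sub (reaches_block_mul ?_ (reaches_block_mul ?_ (reaches_block_nil ?_)))
    · simpa [a3, a2] using l2
    · simpa [a4, a13] using l16
    · simp [a0, a1, a2, a3, a4, a5, a6, a13, am, e, pow_succ]
      lia
  · simp [h0]
  · rintro s' ⟨-, a0, a1, a2, a3, a4, a5, a6, a13, am⟩
    refine reaches_block_nil (hQ _ ?_ am)
    constructor <;> simp [*]

theorem setDiag_spec (hE : Env n s) (hn2 : n * n ≤ M)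
    (hQ : ∀ s', Env n s' →
      (∀ v < n, ∀ u < n, s'.mem (v * n + u) = if u = v then 1 else s.mem (v * n + u)) → Q s') :
    Reaches ω M setDiag s (n * 6 + 3) Q := by
  refine reaches_block_div ?_
  refine reaches_block_loop (fun k s' => k ≤ n ∧ Env n s' ∧ s'.reg 6 = k ∧
    ∀ v < n, ∀ u < n, s'.mem (v * n + u) = if u = v ∧ k ≤ v then 1 else s.mem (v * n + u))
    (by tauto) ?_ ?_ ?_
  · rintro k s' ⟨hk, e, a6, am⟩
    have hle : k * n + k ≤ M := by nlinarith
    refine reaches_block_sub (reaches_block_mul ?_ (reaches_block_add ?_ (reaches_block_store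
      (reaches_block_nil ?_))))
    · simp [a6, e.r0, e.r1]
      lia
    · simpa [a6, e.r0, e.r1] using hle
    · refine ⟨by lia, ?_, ?_, ?_⟩
      · simpa using e
      · simp [a6, e.r1]
      · intro v hv u hu
        -- Addresses are two-digit numbers to base `n`, so distinct matrix entries lie in distinct
        -- cells.
        have key : v * n + u = k * n + k ↔ u = v ∧ v = k := by
          constructor
          · intro h
            have h1 : v = k := by
              rcases lt_trichotomy v k with h' | h' | h'
              · nlinarith
              · exact h'
              · nlinarith
            subst h1
            lia
          · rintro ⟨rfl, rfl⟩
            rfl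
        simp [a6, e.r0, e.r1, key, am v hv u hu]
        split_ifs <;> first | rfl | lia
  · refine ⟨le_rfl, by simpa using hE, by simp [hE.r0, hE.r1], fun v hv u _ => ?_⟩
    rw [if_neg (by lia)]
    rfl
  · rintro s' ⟨-, e, -, am⟩
    refine reaches_block_nil (hQ _ (by simpa using e) ?_)
    simpa using am

end Specs

/-- The elements of the set coded by `X` in the interval `[k, n)`. -/
def bitsFrom (n k X : ℕ) : Finset ℕ :=
  {u ∈ Finset.Ico k n | X.testBit u = true}

theorem bitsFrom_self (n X : ℕ) : bitsFrom n n X = ∅ := by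
  simp [bitsFrom]

theorem mem_bitsFrom {n k X u : ℕ} :
    u ∈ bitsFrom n k X ↔ (k ≤ u ∧ u < n) ∧ X.testBit u = true := by
  simp [bitsFrom]

/-- Loops count down from `n`, so the positions already scanned form an interval `[k, n)`; one round
adds position `k`. -/
theorem bitsFrom_of_testBit {n k X : ℕ} (hk : k < n) (h : X.testBit k = true) :
    bitsFrom n k X = insert k (bitsFrom n (k + 1) X) := by
  ext u
  rw [Finset.mem_insert, mem_bitsFrom, mem_bitsFrom]
  constructor
  · rintro ⟨⟨h1, h2⟩, h3⟩
    by_cases e : u = k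
    · exact .inl e
    · exact .inr ⟨⟨by lia, h2⟩, h3⟩
  · rintro (rfl | ⟨⟨h1, h2⟩, h3⟩)
    exacts [⟨⟨le_rfl, hk⟩, h⟩, ⟨⟨by lia, h2⟩, h3⟩]

theorem bitsFrom_of_not_testBit {n k X : ℕ} (h : ¬ X.testBit k = true) :
    bitsFrom n k X = bitsFrom n (k + 1) X := by
  ext u
  rw [mem_bitsFrom, mem_bitsFrom]
  constructor
  · rintro ⟨⟨h1, h2⟩, h3⟩
    have e : u ≠ k := by
      rintro rfl
      exact h h3
    exact ⟨⟨by lia, h2⟩, h3⟩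
  · rintro ⟨⟨h1, h2⟩, h3⟩
    exact ⟨⟨by lia, h2⟩, h3⟩

theorem exists_bitsFrom {n k X : ℕ} (hk : k < n) (P : ℕ → Prop) :
    (∃ u ∈ bitsFrom n k X, P u) ↔
      (X.testBit k = true ∧ P k) ∨ ∃ u ∈ bitsFrom n (k + 1) X, P u := by
  by_cases h : X.testBit k = true
  · rw [bitsFrom_of_testBit hk h, Finset.exists_mem_insert]
    simp [h]
  · rw [bitsFrom_of_not_testBit h]
    simp [h]

theorem notMem_bitsFrom_succ (n k X : ℕ) : k ∉ bitsFrom n (k + 1) X := by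
  simp [mem_bitsFrom]

theorem card_bitsFrom_le (n k X : ℕ) : (bitsFrom n k X).card ≤ n - k :=
  (Finset.card_filter_le _ _).trans (by simp)

section Specs

variable {ω : ℕ → Bool} {M N n : ℕ} {s : State} {Q : State → Prop}

theorem scanSet_spec {X v x : ℕ} (hE : Env n s) (h6 : s.reg 6 = X)
    (h7 : s.reg 7 = v) (h11 : s.reg 11 = x) (hX : X < 2 ^ n) (hv : v < n) (h2 : 2 ^ n ≤ M)
    (hW : (16 ^ n) ^ n ≤ M) (hn2 : n * n ≤ M)
    (hQ : ∀ s', Env n s' → s'.mem = s.mem → s'.reg 6 = X → s'.reg 7 = v → s'.reg 11 = x →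
      s'.reg 10 = (16 ^ n) ^ (bitsFrom n 0 X).card →
      (s'.reg 12 ≠ 0 ↔ ∃ u ∈ bitsFrom n 0 X, s.mem (v * n + u) ≠ 0) → Q s') :
    Reaches ω M scanSet s (n * 16 + 6) Q := by
  have hM1 : 1 ≤ M := Nat.one_le_two_pow.trans h2
  refine reaches_block_const (by lia) (reaches_block_const hM1 (reaches_block_div
    (reaches_block_div ?_)))
  refine reaches_block_loop (fun k s' => k ≤ n ∧ Env n s' ∧ s'.mem = s.mem ∧ s'.reg 6 = X ∧
    s'.reg 7 = v ∧ s'.reg 11 = x ∧ s'.reg 8 = k ∧ s'.reg 9 = 2 ^ k ∧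
    s'.reg 10 = (16 ^ n) ^ (bitsFrom n k X).card ∧
      (s'.reg 12 ≠ 0 ↔ ∃ u ∈ bitsFrom n k X, s.mem (v * n + u) ≠ 0))
    (by tauto) ?_ ?_ ?_
  · rintro k s' ⟨hk, e, am, a6, a7, a11, a8, a9, a10, a12⟩
    refine reaches_block_sub (reaches_block_div (reaches_bitThen (n := n) (X := X) (j := k) ?_ ?_ ?_
      (by lia) ?_))
    · simpa using e
    · simpa using a6
    · simp [a9, e.r2, pow_succ]
    intro s₂ e₂ bm br b13
    have b6 : s₂.reg 6 = X := by simp [br, a6]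
    have b7 : s₂.reg 7 = v := by simp [br, a7]
    have b8 : s₂.reg 8 = k := by simp [br, a8, e.r1]
    have b9 : s₂.reg 9 = 2 ^ k := by simp [br, a9, e.r2, pow_succ]
    have b10 : s₂.reg 10 = s'.reg 10 := by simp [br]
    have b11 : s₂.reg 11 = x := by simp [br, a11]
    have b12 : s₂.reg 12 = s'.reg 12 := by simp [br]
    have bm' : s₂.mem = s.mem := by simp [bm, am]
    refine reaches_block_ite 7 (fun h => ?_) (fun h => ?_)
    · have hb := b13.1 h
      have hc : (bitsFrom n k X).card = (bitsFrom n (k + 1) X).card + 1 := by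
        rw [bitsFrom_of_testBit hk hb, Finset.card_insert_of_notMem (notMem_bitsFrom_succ n k X)]
      have hle : (16 ^ n) ^ (bitsFrom n k X).card ≤ M :=
        (Nat.pow_le_pow_right (by positivity) ((card_bitsFrom_le n k X).trans
          (Nat.sub_le n k))).trans hW
      have hvn : v * n + k ≤ M := by nlinarith
      refine reaches_block_mul ?_ (reaches_block_mul ?_ (reaches_block_add ?_
        (reaches_block_load (reaches_block_ite 1 (fun h' => ?_) (fun h' => ?_)))))
      · simpa [b10, a10, e₂.r4, hc, pow_succ] using hle
      · simp [b7, e₂.r0]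
        lia
      · simpa [b7, b8, e₂.r0] using hvn
      · have h'' : s.mem (v * n + k) ≠ 0 := by simpa [b7, b8, e₂.r0, bm'] using h'
        refine reaches_const hM1 (reaches_block_nil (reaches_block_nil ?_))
        simp [e₂, bm', b6, b7, b8, b9, b10, b11, a10, e₂.r4, hc, pow_succ, exists_bitsFrom hk,
          hb, h'']
        lia
      · have h'' : s.mem (v * n + k) = 0 := by simpa [b7, b8, e₂.r0, bm'] using h'
        refine reaches_const (Nat.zero_le _) (reaches_block_nil (reaches_block_nil ?_))
        simp [e₂, bm', b6, b7, b8, b9, b10, b11, b12, a10, e₂.r4, hc, pow_succ, exists_bitsFrom hk,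
          h'', ← a12]
        lia
    · have hb : ¬ X.testBit k = true := fun h' => b13.2 h' h
      refine Reaches.mono (N := 1) (reaches_const (Nat.zero_le _) (reaches_block_nil ?_))
        (by simp) (fun _ h => h)
      simp [e₂, bm', b6, b7, b8, b9, b10, b11, b12, a10, bitsFrom_of_not_testBit hb, ← a12]
      lia
  · simp [hE, hE.r0, hE.r1, hE.r3, h6, h7, h11, bitsFrom_self]
  · rintro s' ⟨hk, e, am, a6, a7, a11, a8, a9, a10, a12⟩
    exact reaches_block_nil (hQ _ (by simpa using e) (by simpa using am) (by simpa using a6)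
      (by simpa using a7) (by simpa using a11) (by simpa using a10) (by simpa using a12))

end Specs

/-- The set coded by `X` meets all sets `{u | C v u}`. -/
def Hits (n : ℕ) (C : ℕ → ℕ → Prop) (X : ℕ) : Prop :=
  ∀ v < n, ∃ u ∈ bitsFrom n 0 X, C v u

open Classical in
/-- The weight of the set coded by `X`. -/
noncomputable def weight (n : ℕ) (C : ℕ → ℕ → Prop) (X : ℕ) : ℕ :=
  (16 ^ n) ^ (bitsFrom n 0 X).card * if Hits n C X then 1 else 0

theorem weight_le (n : ℕ) (C : ℕ → ℕ → Prop) (X : ℕ) : weight n C X ≤ (16 ^ n) ^ n := by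
  have h := card_bitsFrom_le n 0 X
  calc weight n C X ≤ (16 ^ n) ^ (bitsFrom n 0 X).card * 1 := by
        refine Nat.mul_le_mul_left _ ?_
        split_ifs <;> simp
    _ ≤ (16 ^ n) ^ n := by
        rw [mul_one]
        exact Nat.pow_le_pow_right (by positivity) h

section Specs

variable {ω : ℕ → Bool} {M N n : ℕ} {s : State} {Q : State → Prop}

open Classical in
theorem testDominating_spec {C : ℕ → ℕ → Prop} {X : ℕ} (hE : Env n s) (hC : StoresRel n C s)
    (hn : 0 < n) (h6 : s.reg 6 = X) (hX : X < 2 ^ n) (h2 : 2 ^ n ≤ M)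
    (hW : (16 ^ n) ^ n ≤ M) (hn2 : n * n ≤ M)
    (hQ : ∀ s', Env n s' → s'.mem = s.mem → s'.reg 6 = X →
      s'.reg 10 = (16 ^ n) ^ (bitsFrom n 0 X).card →
      s'.reg 11 = (if Hits n C X then 1 else 0) → Q s') :
    Reaches ω M testDominating s (n * (n * 16 + 11) + 4) Q := by
  have hM1 : 1 ≤ M := Nat.one_le_two_pow.trans h2
  refine reaches_block_const hM1 (reaches_block_div ?_)
  -- Register 10 receives the weight only when `scanSet` has run at least once, hence the guard `k <
  -- n`; at the exit `k = 0` it is discharged by `0 < n`.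
  refine reaches_block_loop (fun k s' => k ≤ n ∧ Env n s' ∧ s'.mem = s.mem ∧ s'.reg 6 = X ∧
    s'.reg 7 = k ∧ (k < n → s'.reg 10 = (16 ^ n) ^ (bitsFrom n 0 X).card) ∧
    s'.reg 11 = if ∀ v < n, k ≤ v → ∃ u ∈ bitsFrom n 0 X, C v u then 1 else 0)
    (by tauto) ?_ ?_ ?_
  · rintro k s' ⟨hk, e, am, a6, a7, a10, a11⟩
    refine reaches_block_sub (reaches_block_cons (N₁ := n * 16 + 6) (N₂ := 3) ?_)
    refine scanSet_spec (X := X) (v := k) (x := s'.reg 11) (by simpa using e) (by simpa using a6)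
      (by simp [a7, e.r1]) (by simp) hX hk h2 hW hn2 ?_
    intro s₂ e₂ bm b6 b7 b11 b10 b12
    have bm' : s₂.mem = s.mem := by simp [bm, am]
    have hs : (∃ u ∈ bitsFrom n 0 X, (s'.setReg 6 (s'.reg 6)).mem (k * n + u) ≠ 0) ↔
        ∃ u ∈ bitsFrom n 0 X, C k u := by
      refine exists_congr fun u => and_congr_right fun hu => ?_
      rw [← hC k hk u (mem_bitsFrom.1 hu).1.2]
      simp [am]
    have hsplit : (∀ v < n, k ≤ v → ∃ u ∈ bitsFrom n 0 X, C v u) ↔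
        (∃ u ∈ bitsFrom n 0 X, C k u) ∧
          ∀ v < n, k + 1 ≤ v → ∃ u ∈ bitsFrom n 0 X, C v u := by
      constructor
      · intro h
        exact ⟨h k hk le_rfl, fun v hv hkv => h v hv (by lia)⟩
      · rintro ⟨h, h'⟩ v hv hkv
        rcases hkv.eq_or_lt with rfl | hlt
        exacts [h, h' v hv hlt]
    replace b12 := b12.trans hs
    refine reaches_block_ite 1 (fun h => reaches_const (Nat.zero_le _) (reaches_block_nil ?_))
      (fun h => reaches_const (Nat.zero_le _) (reaches_block_nil ?_))
    · have h1 := b12.1 h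
      refine ⟨by lia, by simpa using e₂, by simpa using bm', by simpa using b6, by simpa using b7,
        fun _ => by simpa using b10, ?_⟩
      rw [if_congr hsplit rfl rfl]
      simp only [h1, true_and]
      simpa [b11] using a11
    · have h1 := fun h' => b12.2 h' h
      refine ⟨by lia, by simpa using e₂, by simpa using bm', by simpa using b6, by simpa using b7,
        fun _ => by simpa using b10, ?_⟩
      rw [if_neg fun h' => h1 (hsplit.1 h').1]
      simp
  · refine ⟨le_rfl, by simpa using hE, by simp, by simpa using h6, by simp [hE.r0, hE.r1],
      fun h => absurd h (lt_irrefl n), ?_⟩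
    rw [if_pos fun v hv hv' => absurd hv (not_lt.2 hv')]
    simp
  · rintro s' ⟨hk, e, am, a6, a7, a10, a11⟩
    refine reaches_block_nil (hQ _ (by simpa using e) (by simpa using am) (by simpa using a6)
      (by simpa using a10 hn) ?_)
    simp only [State.setReg_reg]
    exact a11.trans (if_congr (by simp [Hits]) rfl rfl)

theorem fillTable_spec {C : ℕ → ℕ → Prop} (hE : Env n s) (hC : StoresRel n C s)
    (hn : 0 < n) (h2 : n * n + 2 ^ n ≤ M) (hW : (16 ^ n) ^ n ≤ M)
    (hQ : ∀ s', Env n s' → StoresTable n (weight n C) s' → Q s') :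
    Reaches ω M fillTable s (2 ^ n * (n * (n * 16 + 11) + 10) + 3) Q := by
  refine reaches_block_div ?_
  refine reaches_block_loop (fun k s' => k ≤ 2 ^ n ∧ Env n s' ∧ StoresRel n C s' ∧ s'.reg 6 = k ∧
    ∀ X < 2 ^ n, k ≤ X → s'.mem (n * n + X) = weight n C X) (by tauto) ?_ ?_ ?_
  · rintro k s' ⟨hk, e, aC, a6, aT⟩
    refine reaches_block_sub (reaches_block_cons (N₁ := n * (n * 16 + 11) + 4) (N₂ := 4) ?_)
    refine testDominating_spec (X := k) (C := C) (by simpa using e) (by simpa [StoresRel] using aC)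
      hn (by simp [a6, e.r1]) hk (by lia) hW (by lia) ?_
    intro s₂ e₂ bm b6 b10 b11
    have hw : s₂.reg 10 * s₂.reg 11 = weight n C k := by rw [b10, b11, weight]
    refine reaches_block_add ?_ (reaches_block_mul ?_ (reaches_block_store (reaches_block_nil ?_)))
    · simp [e₂.r5, b6]
      lia
    · simpa [hw] using (weight_le n C k).trans hW
    · refine ⟨by lia, by simpa using e₂, ?_, by simpa using b6, ?_⟩
      · intro v hv u hu
        -- The matrix occupies the addresses below `n * n`, so writing to the table leaves it
        -- intact.
        have : v * n + u ≠ n * n + k := by nlinarith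
        simpa [e₂.r5, b6, this, bm] using aC v hv u hu
      · intro X hX hkX
        by_cases h : X = k
        · subst h
          simpa [e₂.r5, b6] using hw
        · simpa [e₂.r5, b6, h, bm] using aT X hX (by lia)
  · refine ⟨le_rfl, by simpa using hE, by simpa [StoresRel] using hC, by simp [hE.r3, hE.r1],
      fun X hX hX' => absurd hX (not_lt.2 hX')⟩
  · rintro s' ⟨hk, e, aC, a6, aT⟩
    refine reaches_block_nil (hQ _ (by simpa using e) ?_)
    intro X hX
    simpa using aT X hX (Nat.zero_le _)

/-- Here `g j` is the table after positions `n - 1` down to `j` have been processed. The update can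
be done in place because `X` runs downwards: the entry at the smaller index `X - 2 ^ j` still has
its old value. Both the zeta and the Moebius transform are instances. -/
theorem transform_spec {o : Op} (g : ℕ → ℕ → ℕ) (hE : Env n s) (hT : StoresTable n (g n) s)
    (h2 : n * n + 2 ^ n ≤ M) (hM : ∀ j < n, ∀ X < 2 ^ n, g j X ≤ M)
    (hg : ∀ j < n, ∀ X < 2 ^ n, g j X =
      if X.testBit j = true then o.apply (g (j + 1) X) (g (j + 1) (X - 2 ^ j)) else g (j + 1) X)
    (hQ : ∀ s', Env n s' → StoresTable n (g 0) s' → Q s') :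
    Reaches ω M (transform o) s (n * (2 ^ n * 15 + 7) + 4) Q := by
  refine reaches_block_div (reaches_block_div ?_)
  refine reaches_block_loop (fun j s' => j ≤ n ∧ Env n s' ∧ s'.reg 7 = j ∧ s'.reg 9 = 2 ^ j ∧
    StoresTable n (g j) s') (by tauto) ?_ ?_ ?_
  · rintro j s' ⟨hj, e, a7, a9, aT⟩
    refine reaches_block_sub (reaches_block_div (reaches_block_cons (N₁ := 2 ^ n * 15 + 3)
      (N₂ := 1) ?_))
    refine reaches_block_div ?_
    refine reaches_block_loop (fun k s' => k ≤ 2 ^ n ∧ Env n s' ∧ s'.reg 7 = j ∧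
      s'.reg 9 = 2 ^ j ∧ s'.reg 6 = k ∧ ∀ X < 2 ^ n, s'.mem (n * n + X) =
        if k ≤ X then g j X else g (j + 1) X) (by tauto) ?_ ?_ ?_
    · rintro k s₁ ⟨hk, e₁, b7, b9, b6, bT⟩
      refine reaches_block_sub (reaches_bitThen (n := n) (X := k) (j := j) (by simpa using e₁)
        (by simp [b6, e₁.r1]) (by simpa using b9) (by lia) ?_)
      intro s₂ e₂ cm cr c13
      have c6 : s₂.reg 6 = k := by simp [cr, b6, e₁.r1]
      have c7 : s₂.reg 7 = j := by simp [cr, b7]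
      have c9 : s₂.reg 9 = 2 ^ j := by simp [cr, b9]
      have cm' : s₂.mem = s₁.mem := by simp [cm]
      refine reaches_block_ite 7 (fun h => ?_) (fun h => ?_)
      · have hb := c13.1 h
        have hjk : 2 ^ j ≤ k := Nat.ge_two_pow_of_testBit hb
        have h2j : 0 < 2 ^ j := by positivity
        have hsub : n * n + k - 2 ^ j = n * n + (k - 2 ^ j) := by lia
        have hval : o.apply (s₁.mem (n * n + k)) (s₁.mem (n * n + (k - 2 ^ j))) = g j k := by
          rw [bT k hk, bT _ (by lia), if_neg (by lia), if_neg (by lia), hg j hj k hk, if_pos hb]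
        refine reaches_block_add ?_ (reaches_block_sub (reaches_block_load (reaches_block_load
          (reaches_block_arith ?_ (reaches_block_store (reaches_block_nil (reaches_block_nil ?_)))))))
        · simp [e₂.r5, c6]
          lia
        · simp [e₂.r5, c6, c9, cm', hsub, hval]
          exact hM j hj k hk
        · refine ⟨by lia, by simpa using e₂, by simpa using c7, by simpa using c9,
            by simpa using c6, fun X hX => ?_⟩
          by_cases hXk : X = k
          · subst hXk
            simp [e₂.r5, c6, c9, cm', hsub, hval]
          · have hle : X < k + 1 ↔ X < k := by lia
            have := bT X hX
            simp [e₂.r5, c6, c9, cm', hXk, this]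
            grind
      · have hb : ¬ k.testBit j = true := fun h' => c13.2 h' h
        refine Reaches.mono (N := 1) (reaches_const (Nat.zero_le _) (reaches_block_nil ?_))
          (by simp) (fun _ h => h)
        refine ⟨by lia, by simpa using e₂, by simpa using c7, by simpa using c9,
            by simpa using c6, fun X hX => ?_⟩
        have := bT X hX
        have h' := hg j hj k hk
        rw [if_neg hb] at h'
        simp [cm', this]
        grind
    · refine ⟨le_rfl, by simpa using e, by simp [a7, e.r1], by simp [a9, e.r2, pow_succ],
        by simp [e.r3, e.r1], fun X hX => ?_⟩
      rw [if_neg (by lia)]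
      simpa using aT X hX
    · rintro s₁ ⟨hk, e₁, b7, b9, b6, bT⟩
      refine reaches_block_nil (reaches_block_nil ⟨by lia, by simpa using e₁, by simpa using b7,
        by simpa using b9, fun X hX => ?_⟩)
      simpa using bT X hX
  · exact ⟨le_rfl, by simpa using hE, by simp [hE.r0, hE.r1], by simp [hE.r3, hE.r1],
      fun X hX => by simpa using hT X hX⟩
  · rintro s' ⟨hj, e, a7, a9, aT⟩
    exact reaches_block_nil (hQ _ (by simpa using e) fun X hX => by simpa using aT X hX)

theorem cubeTable_spec {g : ℕ → ℕ} (hE : Env n s) (hT : StoresTable n g s)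
    (h2 : n * n + 2 ^ n ≤ M) (hM : ∀ X < 2 ^ n, g X ^ 3 ≤ M)
    (hQ : ∀ s', Env n s' → StoresTable n (fun X => g X ^ 3) s' → Q s') :
    Reaches ω M cubeTable s (2 ^ n * 8 + 3) Q := by
  refine reaches_block_div ?_
  refine reaches_block_loop (fun k s' => k ≤ 2 ^ n ∧ Env n s' ∧ s'.reg 6 = k ∧
    ∀ X < 2 ^ n, s'.mem (n * n + X) = if k ≤ X then g X ^ 3 else g X) (by tauto) ?_ ?_ ?_
  · rintro k s' ⟨hk, e, a6, aT⟩
    have hval : s'.mem (n * n + k) = g k := by rw [aT k hk, if_neg (by lia)]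
    refine reaches_block_sub (reaches_block_add ?_ (reaches_block_load (reaches_block_mul ?_
      (reaches_block_mul ?_ (reaches_block_store (reaches_block_nil ?_))))))
    · simp [e.r5, a6, e.r1]
      lia
    · simp [e.r5, a6, e.r1, hval]
      refine le_trans ?_ (hM k hk)
      -- The intermediate square must be bounded too; it is at most the cube, the value 0 being
      -- treated apart.
      rcases Nat.eq_zero_or_pos (g k) with h | h
      · simp [h]
      · nlinarith [Nat.mul_le_mul_left (g k * g k) h]
    · simp [e.r5, a6, e.r1, hval]
      exact le_trans (by ring_nf; rfl) (hM k hk)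
    · refine ⟨by lia, by simpa using e, by simp [a6, e.r1], fun X hX => ?_⟩
      by_cases hXk : X = k
      · subst hXk
        simp [e.r5, a6, e.r1, hval]
        ring
      · have := aT X hX
        simp [e.r5, a6, e.r1, hXk, this]
        grind
  · refine ⟨le_rfl, by simpa using hE, by simp [hE.r3, hE.r1], fun X hX => ?_⟩
    rw [if_neg (by lia)]
    simpa using hT X hX
  · rintro s' ⟨hk, e, a6, aT⟩
    refine reaches_block_nil (hQ _ (by simpa using e) fun X hX => ?_)
    simpa using aT X hX

theorem extract_spec {g : ℕ → ℕ} (hE : Env n s) (hT : StoresTable n g s)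
    (h2 : n * n + 2 ^ n ≤ M) (hW : (16 ^ n) ^ n ≤ M)
    (hQ : ∀ s', s'.reg 0 = g (2 ^ n - 1) / (16 ^ n) ^ n % 16 ^ n → Q s') :
    Reaches ω M extract s (n * 4 + 11) Q := by
  have h2n : 1 ≤ 2 ^ n := Nat.one_le_two_pow
  refine reaches_block_const (by lia) (reaches_block_div ?_)
  refine reaches_block_loop (fun k s' => k ≤ n ∧ Env n s' ∧ s'.reg 6 = k ∧ StoresTable n g s' ∧
    s'.reg 10 = (16 ^ n) ^ (n - k)) (by tauto) ?_ ?_ ?_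
  · rintro k s' ⟨hk, e, a6, aT, a10⟩
    have hk' : n - k = n - (k + 1) + 1 := by lia
    refine reaches_block_sub (reaches_block_mul ?_ (reaches_block_nil ?_))
    · simp [e.r4, a10, ← pow_succ]
      exact (Nat.pow_le_pow_right (by positivity) (by lia)).trans hW
    · refine ⟨by lia, by simpa using e, by simp [a6, e.r1], fun X hX => by simpa using aT X hX, ?_⟩
      simp [e.r4, a10, hk', pow_succ]
  · exact ⟨le_rfl, by simpa using hE, by simp [hE.r0, hE.r1], fun X hX => by simpa using hT X hX,
      by simp⟩
  · rintro s' ⟨hk, e, a6, aT, a10⟩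
    have hval := aT (2 ^ n - 1) (by lia)
    have haddr : n * n + 2 ^ n - 1 = n * n + (2 ^ n - 1) := by lia
    -- The product that occurs in computing the remainder is at most the table entry itself, so its
    -- bound comes from the boundedness `hb` of the current state.
    refine fun hb => reaches_block_add ?_ (reaches_block_sub (reaches_block_load (reaches_block_div
      (reaches_block_div (reaches_block_mul ?_ (reaches_block_sub (reaches_block_nil
      (hQ _ ?_)))))))) hb
    · simpa [e.r5, e.r3] using h2
    · simp [e.r5, e.r3, e.r1, e.r4, a10, haddr]
      exact ((Nat.div_mul_le_self _ _).trans (Nat.div_le_self _ _)).trans (hb.mem _)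
    · simp [e.r5, e.r3, e.r1, e.r4, a10, haddr, hval]
      rw [Nat.mod_def, mul_comm]

end Specs

/-! ### Binary codes of sets, and the zeta and Moebius transforms. -/

/-- Adding `2 ^ j` to a number whose bit `j` is clear produces no carry. -/
theorem testBit_two_pow_add_of_ne {Y j u : ℕ} (hY : Y.testBit j = false) (h : u ≠ j) :
    (2 ^ j + Y).testBit u = Y.testBit u := by
  induction j generalizing Y u with
  | zero =>
    obtain ⟨u, rfl⟩ := Nat.exists_eq_succ_of_ne_zero h
    rw [Nat.testBit_zero, decide_eq_false_iff_not] at hY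
    rw [Nat.succ_eq_add_one, Nat.testBit_add_one, Nat.testBit_add_one]
    congr 1
    lia
  | succ j ih =>
    have h2 : 2 ^ (j + 1) + Y = Y + 2 * 2 ^ j := by ring
    cases u with
    | zero => rw [h2, Nat.testBit_zero, Nat.testBit_zero, Nat.add_mul_mod_self_left]
    | succ u =>
      rw [Nat.testBit_add_one] at hY ⊢
      rw [Nat.testBit_add_one, ← ih hY (by lia)]
      congr 1
      lia

theorem bitsFrom_subset (n k X : ℕ) : bitsFrom n k X ⊆ Finset.range n := fun _ hu =>
  Finset.mem_range.2 (mem_bitsFrom.1 hu).1.2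

theorem bitsFrom_sub_two_pow {n X j : ℕ} (h : X.testBit j = true) :
    bitsFrom n 0 (X - 2 ^ j) = (bitsFrom n 0 X).erase j := by
  have hle := Nat.ge_two_pow_of_testBit h
  obtain ⟨Y, rfl⟩ : ∃ Y, X = 2 ^ j + Y := ⟨X - 2 ^ j, by lia⟩
  rw [Nat.add_sub_cancel_left]
  have hY : Y.testBit j = false := by
    rw [Nat.testBit_two_pow_add_eq] at h
    simpa using h
  ext u
  rw [Finset.mem_erase, mem_bitsFrom, mem_bitsFrom]
  by_cases e : u = j
  · subst e
    simp [hY]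
  · simp [e, testBit_two_pow_add_of_ne hY e]

theorem bitsFrom_two_pow_sub_one (n : ℕ) : bitsFrom n 0 (2 ^ n - 1) = Finset.range n := by
  ext u
  simp [mem_bitsFrom, Nat.testBit_two_pow_sub_one]

section Zeta

variable (f : Finset ℕ → ℕ) (n : ℕ)

/-- The sum of `f D` over the subsets `D` of `S` that agree with `S` below `j`. -/
def zetaFrom (j : ℕ) (S : Finset ℕ) : ℕ :=
  ∑ D ∈ S.powerset with S \ D ⊆ Finset.Ico j n, f D

theorem zetaFrom_self (S : Finset ℕ) : zetaFrom f n n S = f S := by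
  have : {D ∈ S.powerset | S \ D ⊆ Finset.Ico n n} = {S} := by
    ext D
    simp only [Finset.Ico_self, Finset.subset_empty, Finset.mem_filter, Finset.mem_powerset,
      Finset.sdiff_eq_empty_iff_subset, Finset.mem_singleton]
    exact ⟨fun h => h.1.antisymm h.2, by rintro rfl; simp⟩
  rw [zetaFrom, this, Finset.sum_singleton]

theorem zetaFrom_zero {S : Finset ℕ} (hS : S ⊆ Finset.range n) :
    zetaFrom f n 0 S = ∑ D ∈ S.powerset, f D := by
  rw [zetaFrom, Finset.filter_true_of_mem]
  intro D _
  rw [← Finset.range_eq_Ico]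
  exact Finset.sdiff_subset.trans hS

/-- Split the sets `D` by whether they contain `j`: those that do differ from `S` only beyond `j`,
the others are subsets of `S.erase j`. -/
theorem zetaFrom_of_mem {j : ℕ} (hj : j < n) {S : Finset ℕ} (h : j ∈ S) :
    zetaFrom f n j S = zetaFrom f n (j + 1) S + zetaFrom f n (j + 1) (S.erase j) := by
  rw [zetaFrom, zetaFrom, zetaFrom, ← Finset.sum_union]
  · congr 1
    ext D
    simp only [Finset.mem_filter, Finset.mem_powerset, Finset.mem_union, Finset.subset_iff,
      Finset.mem_sdiff, Finset.mem_Ico, Finset.mem_erase]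
    grind
  · rw [Finset.disjoint_left]
    intro D
    simp only [Finset.mem_filter, Finset.mem_powerset, Finset.subset_iff,
      Finset.mem_sdiff, Finset.mem_Ico, Finset.mem_erase]
    grind

theorem zetaFrom_of_notMem {j : ℕ} {S : Finset ℕ} (h : j ∉ S) :
    zetaFrom f n j S = zetaFrom f n (j + 1) S := by
  rw [zetaFrom, zetaFrom]
  congr 1
  ext D
  simp only [Finset.mem_filter, Finset.mem_powerset, Finset.subset_iff,
    Finset.mem_sdiff, Finset.mem_Ico]
  grind

theorem zetaFrom_le (j : ℕ) {S : Finset ℕ} (hS : S ⊆ Finset.range n) :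
    zetaFrom f n j S ≤ ∑ D ∈ (Finset.range n).powerset, f D :=
  Finset.sum_le_sum_of_subset ((Finset.filter_subset _ _).trans (Finset.powerset_mono.2 hS))

/-- The union of a triple of sets. -/
def tripleUnion (t : Finset ℕ × Finset ℕ × Finset ℕ) : Finset ℕ :=
  t.1 ∪ (t.2.1 ∪ t.2.2)

/-- The triples of subsets of `S`. -/
def triples (S : Finset ℕ) : Finset (Finset ℕ × Finset ℕ × Finset ℕ) :=
  S.powerset ×ˢ S.powerset ×ˢ S.powerset

theorem mem_triples {S : Finset ℕ} {t : Finset ℕ × Finset ℕ × Finset ℕ} :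
    t ∈ triples S ↔ tripleUnion t ⊆ S := by
  simp [triples, tripleUnion, Finset.union_subset_iff]

/-- The product of the values of `f` on a triple of sets. -/
def tripleProd (t : Finset ℕ × Finset ℕ × Finset ℕ) : ℕ :=
  f t.1 * (f t.2.1 * f t.2.2)

theorem sum_tripleProd (S : Finset ℕ) :
    ∑ t ∈ triples S, tripleProd f t = (∑ D ∈ S.powerset, f D) ^ 3 := by
  simp only [triples, tripleProd, Finset.sum_product, ← Finset.mul_sum, ← Finset.sum_mul]
  ring

/-- The sum over the triples with union contained in `S` and containing all elements of `S` from
`j` on. -/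
def moebiusFrom (j : ℕ) (S : Finset ℕ) : ℕ :=
  ∑ t ∈ triples S with S ∩ Finset.Ico j n ⊆ tripleUnion t, tripleProd f t

theorem moebiusFrom_self (S : Finset ℕ) :
    moebiusFrom f n n S = (∑ D ∈ S.powerset, f D) ^ 3 := by
  rw [moebiusFrom, ← sum_tripleProd, Finset.filter_true_of_mem]
  simp

theorem moebiusFrom_zero :
    moebiusFrom f n 0 (Finset.range n) =
      ∑ t ∈ triples (Finset.range n) with tripleUnion t = Finset.range n, tripleProd f t := by
  rw [moebiusFrom]
  congr 1
  ext t
  rw [Finset.mem_filter, Finset.mem_filter, ← Finset.range_eq_Ico, Finset.inter_self, mem_triples]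
  exact and_congr_right fun h => ⟨fun h' => h.antisymm h', fun h' => h'.ge⟩

/-- Among the triples inside `S` that cover its elements beyond `j`, those whose union misses `j`
are exactly the ones inside `S.erase j`. The subtrahend is thus part of the minuend, so truncated
subtraction loses nothing. -/
theorem moebiusFrom_of_mem {j : ℕ} (hj : j < n) {S : Finset ℕ} (h : j ∈ S) :
    moebiusFrom f n j S = moebiusFrom f n (j + 1) S - moebiusFrom f n (j + 1) (S.erase j) := by
  refine (Nat.sub_eq_of_eq_add ?_).symm
  rw [moebiusFrom, moebiusFrom, moebiusFrom, ← Finset.sum_union]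
  · congr 1
    ext t
    simp only [Finset.mem_filter, mem_triples, Finset.mem_union, Finset.subset_iff,
      Finset.mem_inter, Finset.mem_Ico, Finset.mem_erase]
    grind
  · rw [Finset.disjoint_left]
    intro t
    simp only [Finset.mem_filter, mem_triples, Finset.subset_iff,
      Finset.mem_inter, Finset.mem_Ico, Finset.mem_erase]
    grind

theorem moebiusFrom_of_notMem {j : ℕ} {S : Finset ℕ} (h : j ∉ S) :
    moebiusFrom f n j S = moebiusFrom f n (j + 1) S := by
  rw [moebiusFrom, moebiusFrom]
  congr 1
  ext t
  simp only [Finset.mem_filter, mem_triples, Finset.subset_iff, Finset.mem_inter, Finset.mem_Ico]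
  grind

theorem moebiusFrom_le (j : ℕ) {S : Finset ℕ} (hS : S ⊆ Finset.range n) :
    moebiusFrom f n j S ≤ (∑ D ∈ (Finset.range n).powerset, f D) ^ 3 := by
  rw [← sum_tripleProd]
  refine Finset.sum_le_sum_of_subset ((Finset.filter_subset _ _).trans fun t ht => ?_)
  exact mem_triples.2 ((mem_triples.1 ht).trans hS)

end Zeta

/-- After division by `W ^ n`, terms with exponent `n` contribute 1 each and all others are
multiples of `W`; having fewer than `W` terms excludes a carry. -/
theorem sum_pow_div_mod {ι : Type*} (s : Finset ι) (e : ι → ℕ) {W n : ℕ} (hW : s.card < W)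
    (he : ∀ i ∈ s, n ≤ e i) :
    (∑ i ∈ s, W ^ e i) / W ^ n % W = {i ∈ s | e i = n}.card := by
  have hW0 : 0 < W := by lia
  have h1 : ∑ i ∈ s, W ^ e i = W ^ n * ∑ i ∈ s, W ^ (e i - n) := by
    rw [Finset.mul_sum]
    refine Finset.sum_congr rfl fun i hi => ?_
    rw [← pow_add, Nat.add_sub_cancel' (he i hi)]
  have h2 : ∑ i ∈ s with ¬ e i = n, W ^ (e i - n) =
      W * ∑ i ∈ s with ¬ e i = n, W ^ (e i - n - 1) := by
    rw [Finset.mul_sum]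
    refine Finset.sum_congr rfl fun i hi => ?_
    rw [Finset.mem_filter] at hi
    have := he i hi.1
    rw [← pow_succ']
    congr 1
    lia
  have h3 : ∑ i ∈ s with e i = n, W ^ (e i - n) = {i ∈ s | e i = n}.card := by
    rw [Finset.card_eq_sum_ones]
    refine Finset.sum_congr rfl fun i hi => ?_
    rw [(Finset.mem_filter.1 hi).2, Nat.sub_self, pow_zero]
  rw [h1, Nat.mul_div_cancel_left _ (pow_pos hW0 n),
    ← Finset.sum_filter_add_sum_filter_not s (fun i => e i = n), h2, h3, Nat.add_mul_mod_self_left]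
  exact Nat.mod_eq_of_lt ((Finset.card_filter_le _ _).trans_lt hW)

/-- The excess of the sum of the cardinalities over that of the union is a sum of cardinalities of
intersections, which vanishes only if all of these are empty. -/
theorem card_triple_eq_iff (t : Finset ℕ × Finset ℕ × Finset ℕ) :
    t.1.card + (t.2.1.card + t.2.2.card) = (tripleUnion t).card ↔
      Disjoint t.1 t.2.1 ∧ Disjoint t.1 t.2.2 ∧ Disjoint t.2.1 t.2.2 := by
  have h1 := Finset.card_union_add_card_inter t.1 (t.2.1 ∪ t.2.2)
  have h2 := Finset.card_union_add_card_inter t.2.1 t.2.2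
  rw [← and_assoc, ← Finset.disjoint_union_right]
  simp only [Finset.disjoint_iff_inter_eq_empty, ← Finset.card_eq_zero, tripleUnion]
  lia

theorem card_tripleUnion_le (t : Finset ℕ × Finset ℕ × Finset ℕ) :
    (tripleUnion t).card ≤ t.1.card + (t.2.1.card + t.2.2.card) := by
  have h1 := Finset.card_union_le t.1 (t.2.1 ∪ t.2.2)
  have h2 := Finset.card_union_le t.2.1 t.2.2
  rw [tripleUnion]
  lia

theorem card_triples_range (n : ℕ) : (triples (Finset.range n)).card = 8 ^ n := by
  simp only [triples, Finset.card_product, Finset.card_powerset, Finset.card_range, ← mul_pow]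
  norm_num

/-! ### Reading off the number of partitions, and correctness of the whole program. -/

section Dominating

variable (n : ℕ) (C : ℕ → ℕ → Prop)

/-- `D` meets all sets `{u | C v u}`. -/
def Meets (D : Finset ℕ) : Prop :=
  ∀ v < n, ∃ u ∈ D, C v u

open Classical in
/-- The weight of a set, as a function on finite sets. -/
noncomputable def setWeight (D : Finset ℕ) : ℕ :=
  (16 ^ n) ^ D.card * if Meets n C D then 1 else 0

/-- There is a partition into three sets that meet all sets `{u | C v u}`. -/
def HasTriple : Prop :=
  ∃ t ∈ triples (Finset.range n), tripleUnion t = Finset.range n ∧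
    (Meets n C t.1 ∧ Meets n C t.2.1 ∧ Meets n C t.2.2) ∧
      Disjoint t.1 t.2.1 ∧ Disjoint t.1 t.2.2 ∧ Disjoint t.2.1 t.2.2

theorem moebiusFrom_digit (hn : 0 < n) :
    moebiusFrom (setWeight n C) n 0 (Finset.range n) / (16 ^ n) ^ n % 16 ^ n ≠ 0 ↔
      HasTriple n C := by
  classical
  have h : moebiusFrom (setWeight n C) n 0 (Finset.range n) =
      ∑ t ∈ triples (Finset.range n) with tripleUnion t = Finset.range n ∧
        (Meets n C t.1 ∧ Meets n C t.2.1 ∧ Meets n C t.2.2),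
        (16 ^ n) ^ (t.1.card + (t.2.1.card + t.2.2.card)) := by
    rw [moebiusFrom_zero, ← Finset.filter_filter, Finset.sum_filter (fun t => Meets n C _ ∧ _)]
    refine Finset.sum_congr rfl fun t _ => ?_
    simp only [tripleProd, setWeight]
    split_ifs <;> first | (exfalso; tauto) | ring
  rw [h, sum_pow_div_mod, Finset.card_ne_zero, HasTriple]
  · refine exists_congr fun t => ?_
    rw [Finset.mem_filter, Finset.mem_filter, and_assoc, and_assoc]
    refine and_congr_right fun _ => and_congr_right fun hU => and_congr_right fun _ => ?_
    rw [← card_triple_eq_iff, hU, Finset.card_range]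
  · refine (Finset.card_filter_le _ _).trans_lt ?_
    rw [card_triples_range]
    exact Nat.pow_lt_pow_left (by simp) (by lia)
  · intro t ht
    have := card_tripleUnion_le t
    rwa [(Finset.mem_filter.1 ht).2.1, Finset.card_range] at this

theorem sum_setWeight_le : ∑ D ∈ (Finset.range n).powerset, setWeight n C D ≤
    2 ^ n * (16 ^ n) ^ n := by
  refine (Finset.sum_le_card_nsmul _ _ ((16 ^ n) ^ n) fun D hD => ?_).trans (by simp)
  calc setWeight n C D ≤ (16 ^ n) ^ D.card * 1 := by
        refine Nat.mul_le_mul_left _ ?_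
        split_ifs <;> simp
    _ ≤ (16 ^ n) ^ n := by
        rw [mul_one]
        refine Nat.pow_le_pow_right (by positivity) ?_
        simpa using Finset.card_le_card (Finset.mem_powerset.1 hD)

end Dominating

theorem threeDomatic_spec {ω : ℕ → Bool} {n : ℕ} {s : State} {C : ℕ → ℕ → Prop} (hn : 0 < n)
    (h0 : s.reg 0 = n)
    (hC : ∀ v < n, ∀ u < n, (if u = v then 1 else s.mem (v * n + u)) ≠ 0 ↔ C v u) :
    Reaches ω (2 ^ (16 * n ^ 2)) threeDomatic s (2 ^ n * (16 * n ^ 2 + 70 * n + 56))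
      fun s' => s'.reg 0 ≠ 0 ↔ HasTriple n C := by
  -- The largest numbers are the cubed sums, at most `(2 ^ n * (16 ^ n) ^ n) ^ 3 = 2 ^ (3 * n + 12 *
  -- n ^ 2)`.
  set M := 2 ^ (16 * n ^ 2) with hMdef
  have hnn : n ≤ n ^ 2 := Nat.le_self_pow (by simp) n
  have hW : (16 ^ n) ^ n ≤ M := by
    rw [hMdef, show 16 = 2 ^ 4 by rfl, ← pow_mul, ← pow_mul]
    exact Nat.pow_le_pow_right (by simp) (by nlinarith)
  have h16 : 16 ^ n ≤ M := (Nat.le_self_pow hn.ne' _).trans hW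
  have h2 : 2 ^ n ≤ M := Nat.pow_le_pow_right (by simp) (by nlinarith)
  have hn2 : n * n + 2 ^ n ≤ M := by
    have hlt : n < 2 ^ n := Nat.lt_two_pow_self
    calc n * n + 2 ^ n ≤ 2 ^ n * 2 ^ n + 2 ^ n * 2 ^ n := by
          nlinarith [Nat.mul_le_mul hlt.le hlt.le]
      _ = 2 ^ (2 * n + 1) := by ring
      _ ≤ M := Nat.pow_le_pow_right (by simp) (by nlinarith)
  set f := setWeight n C with hf
  have hsum : (∑ D ∈ (Finset.range n).powerset, f D) ^ 3 ≤ M := by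
    calc (∑ D ∈ (Finset.range n).powerset, f D) ^ 3 ≤ (2 ^ n * (16 ^ n) ^ n) ^ 3 :=
          Nat.pow_le_pow_left (sum_setWeight_le n C) 3
      _ = 2 ^ (3 * n + 12 * n ^ 2) := by
          rw [show 16 = 2 ^ 4 by rfl, ← pow_mul, ← pow_mul, ← pow_add, ← pow_mul]
          congr 1
          ring
      _ ≤ M := Nat.pow_le_pow_right (by simp) (by lia)
  have hsum' : ∑ D ∈ (Finset.range n).powerset, f D ≤ M :=
    (Nat.le_self_pow (by simp) _).trans hsum
  refine Reaches.mono (reaches_block_cons (initRegs_spec h0 hn h2 h16 (by lia) fun s₁ e₁ m₁ =>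
    reaches_block_cons (setDiag_spec e₁ (by lia) fun s₂ e₂ m₂ =>
    reaches_block_cons (fillTable_spec (C := C) e₂ ?_ hn hn2 hW fun s₃ e₃ t₃ =>
    reaches_block_cons (transform_spec (fun j X => zetaFrom f n j (bitsFrom n 0 X)) e₃ ?_ hn2 ?_ ?_
      fun s₄ e₄ t₄ =>
    reaches_block_cons (cubeTable_spec e₄ t₄ hn2 ?_ fun s₅ e₅ t₅ =>
    reaches_block_cons (transform_spec (fun j X => moebiusFrom f n j (bitsFrom n 0 X)) e₅ ?_ hn2
      ?_ ?_ fun s₆ e₆ t₆ =>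
    reaches_block_cons (extract_spec e₆ t₆ hn2 hW fun s₇ h₇ => reaches_block_nil
      (Q := fun s' => s'.reg 0 ≠ 0 ↔ HasTriple n C) ?_))))))))
    ?_ (fun _ h => h)
  · intro v hv u hu
    rw [m₂ v hv u hu, m₁]
    exact hC v hv u hu
  · intro X hX
    rw [t₃ X hX]
    exact (zetaFrom_self f n _).symm
  · exact fun j _ X _ => (zetaFrom_le f n j (bitsFrom_subset n 0 X)).trans hsum'
  · intro j hj X _
    have hm : j ∈ bitsFrom n 0 X ↔ X.testBit j = true := by simp [mem_bitsFrom, hj]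
    split_ifs with h
    · rw [bitsFrom_sub_two_pow h]
      exact zetaFrom_of_mem f n hj (hm.2 h)
    · exact zetaFrom_of_notMem f n fun h' => h (hm.1 h')
  · exact fun X _ => (Nat.pow_le_pow_left (zetaFrom_le f n 0 (bitsFrom_subset n 0 X)) 3).trans hsum
  · intro X hX
    rw [t₅ X hX]
    exact (congrArg (· ^ 3) (zetaFrom_zero f n (bitsFrom_subset n 0 X))).trans
      (moebiusFrom_self f n _).symm
  · exact fun j _ X _ => (moebiusFrom_le f n j (bitsFrom_subset n 0 X)).trans hsum
  · intro j hj X _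
    have hm : j ∈ bitsFrom n 0 X ↔ X.testBit j = true := by simp [mem_bitsFrom, hj]
    split_ifs with h
    · rw [bitsFrom_sub_two_pow h]
      exact moebiusFrom_of_mem f n hj (hm.2 h)
    · exact moebiusFrom_of_notMem f n fun h' => h (hm.1 h')
  · rw [← moebiusFrom_digit n C hn]
    simp only [State.setReg_reg, OfNat.zero_ne_ofNat, ↓reduceIte]
    rw [h₇, bitsFrom_two_pow_sub_one]
  · have h1 : 1 ≤ 2 ^ n := Nat.one_le_two_pow
    have h3 : 29 * n + 38 ≤ 2 ^ n * (29 * n + 38) := Nat.le_mul_of_pos_left _ (by lia)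
    calc _ = 2 ^ n * (16 * n ^ 2 + 41 * n + 18) + (29 * n + 38) := by ring
      _ ≤ 2 ^ n * (16 * n ^ 2 + 41 * n + 18) + 2 ^ n * (29 * n + 38) := by lia
      _ = _ := by ring

/-! ### Domatic partitions in terms of triples of number sets, and the input encoding. -/

section Graphs

theorem isDominating_iff {V : Type*} {G : SimpleGraph V} {D : Set V} :
    IsDominating G D ↔ ∀ v, ∃ u ∈ D, u = v ∨ G.Adj v u := by
  rw [IsDominating, Set.eq_univ_iff_forall]
  refine forall_congr' fun v => ?_
  simp only [closedNeighborSet, Set.mem_iUnion, Set.mem_union, SimpleGraph.mem_neighborSet,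
    Set.mem_singleton_iff, exists_prop, G.adj_comm v, eq_comm (a := v)]
  exact exists_congr fun u => and_congr_right fun _ => or_comm

theorem IsDominating.mono {V : Type*} {G : SimpleGraph V} {D D' : Set V} (h : IsDominating G D)
    (hD : D ⊆ D') : IsDominating G D' := by
  rw [isDominating_iff] at h ⊢
  intro v
  obtain ⟨u, hu, h'⟩ := h v
  exact ⟨u, hD hu, h'⟩

/-- Keep two classes and merge all the others into one; this union dominates because it contains a
third class. -/
theorem HasDomaticPartition.three {V : Type*} {G : SimpleGraph V} {k : ℕ} (hk : 3 ≤ k)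
    (h : HasDomaticPartition G k) : HasDomaticPartition G 3 := by
  obtain ⟨P, -, hd, hdom⟩ := h
  let i₀ : Fin k := ⟨0, by lia⟩
  let i₁ : Fin k := ⟨1, by lia⟩
  let i₂ : Fin k := ⟨2, by lia⟩
  have h01 : Disjoint (P i₀) (P i₁) := hd (by simp [i₀, i₁])
  have h02 : Disjoint (P i₂) (P i₀) := hd (by simp [i₀, i₂])
  have h12 : Disjoint (P i₂) (P i₁) := hd (by simp [i₁, i₂])
  refine ⟨![P i₀, P i₁, (P i₀ ∪ P i₁)ᶜ], ?_, ?_, ?_⟩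
  · refine Set.eq_univ_of_forall fun v => ?_
    simp only [Set.mem_iUnion, Fin.exists_fin_succ]
    simp
    tauto
  · have d0 : Disjoint (P i₀) (P i₀ ∪ P i₁)ᶜ :=
      Set.disjoint_compl_right_iff_subset.2 Set.subset_union_left
    have d1 : Disjoint (P i₁) (P i₀ ∪ P i₁)ᶜ :=
      Set.disjoint_compl_right_iff_subset.2 Set.subset_union_right
    intro i j hij
    fin_cases i <;> fin_cases j <;>
      first | exact absurd rfl hij | exact h01 | exact h01.symm | exact d0 | exact d1 |
        exact d0.symm | exact d1.symm
  · intro i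
    fin_cases i
    · exact hdom i₀
    · exact hdom i₁
    · refine (hdom i₂).mono ?_
      exact Set.subset_compl_iff_disjoint_right.2 (Set.disjoint_union_right.2 ⟨h02, h12⟩)

theorem three_le_domaticNumber_iff {V : Type*} {G : SimpleGraph V} :
    3 ≤ domaticNumber G ↔ HasDomaticPartition G 3 := by
  constructor
  · intro h
    by_contra hn
    have h2 : domaticNumber G ≤ 2 := by
      refine iSup₂_le fun k hk => ?_
      have : k ≤ 2 := by
        by_contra hk'
        exact hn (hk.three (by lia))
      exact_mod_cast this
    have := h.trans h2
    norm_num at this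
  · intro h
    exact le_iSup₂_of_le (f := fun k (_ : HasDomaticPartition G k) => (k : ℕ∞)) 3 h le_rfl

/-- Closed adjacency between vertices given as numbers. -/
def ClosedAdj {n : ℕ} (G : SimpleGraph (Fin n)) (v u : ℕ) : Prop :=
  ∃ i j : Fin n, v = i ∧ u = j ∧ (j = i ∨ G.Adj i j)

theorem closedAdj_iff {n : ℕ} {G : SimpleGraph (Fin n)} {i j : Fin n} :
    ClosedAdj G i j ↔ j = i ∨ G.Adj i j := by
  constructor
  · rintro ⟨i', j', hi, hj, h⟩
    obtain rfl := Fin.ext hi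
    obtain rfl := Fin.ext hj
    exact h
  · exact fun h => ⟨i, j, rfl, rfl, h⟩

theorem meets_iff {n : ℕ} {G : SimpleGraph (Fin n)} {D : Finset ℕ} (hD : D ⊆ Finset.range n) :
    Meets n (ClosedAdj G) D ↔ IsDominating G {i : Fin n | (i : ℕ) ∈ D} := by
  rw [isDominating_iff]
  constructor
  · intro h v
    obtain ⟨u, hu, huv⟩ := h v v.2
    have hun := Finset.mem_range.1 (hD hu)
    exact ⟨⟨u, hun⟩, hu, closedAdj_iff.1 huv⟩
  · intro h v hv
    obtain ⟨u, hu, huv⟩ := h ⟨v, hv⟩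
    exact ⟨u, hu, ⟨v, hv⟩, u, rfl, rfl, huv⟩

theorem hasTriple_iff {n : ℕ} (G : SimpleGraph (Fin n)) :
    HasTriple n (ClosedAdj G) ↔ HasDomaticPartition G 3 := by
  classical
  constructor
  · rintro ⟨⟨D₀, D₁, D₂⟩, ht, hU, ⟨m0, m1, m2⟩, d01, d02, d12⟩
    rw [mem_triples] at ht
    simp only [tripleUnion, Finset.union_subset_iff] at ht hU m0 m1 m2 d01 d02 d12
    have key : ∀ D D' : Finset ℕ, Disjoint D D' →
        Disjoint {i : Fin n | (i : ℕ) ∈ D} {i : Fin n | (i : ℕ) ∈ D'} := fun D D' h =>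
      Set.disjoint_left.2 fun i hi hi' => Finset.disjoint_left.1 h hi hi'
    have k01 := key _ _ d01
    have k02 := key _ _ d02
    have k12 := key _ _ d12
    refine ⟨![{i | (i : ℕ) ∈ D₀}, {i | (i : ℕ) ∈ D₁}, {i | (i : ℕ) ∈ D₂}], ?_, ?_, ?_⟩
    · refine Set.eq_univ_of_forall fun v => ?_
      have hv : (v : ℕ) ∈ D₀ ∪ (D₁ ∪ D₂) := by
        rw [hU]
        exact Finset.mem_range.2 v.2
      simp only [Finset.mem_union] at hv
      simpa [Fin.exists_fin_succ] using hv
    · intro i j hij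
      fin_cases i <;> fin_cases j <;>
        first | exact absurd rfl hij | exact k01 | exact k01.symm | exact k02 | exact k02.symm |
          exact k12 | exact k12.symm
    · intro i
      fin_cases i
      · exact (meets_iff ht.1).1 m0
      · exact (meets_iff ht.2.1).1 m1
      · exact (meets_iff ht.2.2).1 m2
  · rintro ⟨P, hU, hd, hdom⟩
    let D : Fin 3 → Finset ℕ := fun i => (Finset.univ.filter (· ∈ P i)).image Fin.val
    have hmem : ∀ i x, x ∈ D i ↔ ∃ h : x < n, (⟨x, h⟩ : Fin n) ∈ P i := by
      intro i x
      simp only [D, Finset.mem_image, Finset.mem_filter_univ]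
      constructor
      · rintro ⟨y, hy, rfl⟩
        exact ⟨y.2, hy⟩
      · rintro ⟨h, hx⟩
        exact ⟨_, hx, rfl⟩
    have hsub : ∀ i, D i ⊆ Finset.range n := fun i x hx =>
      Finset.mem_range.2 ((hmem i x).1 hx).1
    have hmeets : ∀ i, Meets n (ClosedAdj G) (D i) := fun i => by
      rw [meets_iff (hsub i)]
      convert hdom i using 1
      ext x
      simp [hmem]
    have hdisj : ∀ i j, i ≠ j → Disjoint (D i) (D j) := fun i j hij =>
      Finset.disjoint_left.2 fun x hx hx' => by
        obtain ⟨h, hx⟩ := (hmem i x).1 hx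
        obtain ⟨_, hx'⟩ := (hmem j x).1 hx'
        exact Set.disjoint_left.1 (hd hij) hx hx'
    have hsub' : tripleUnion (D 0, D 1, D 2) ⊆ Finset.range n :=
      Finset.union_subset (hsub 0) (Finset.union_subset (hsub 1) (hsub 2))
    refine ⟨(D 0, D 1, D 2), mem_triples.2 hsub', hsub'.antisymm fun x hx => ?_,
      ⟨hmeets 0, hmeets 1, hmeets 2⟩, hdisj 0 1 (by simp), hdisj 0 2 (by simp),
      hdisj 1 2 (by simp)⟩
    have hxn := Finset.mem_range.1 hx
    obtain ⟨i, hi⟩ := Set.mem_iUnion.1 (hU.ge (Set.mem_univ (⟨x, hxn⟩ : Fin n)))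
    have hxi := (hmem i x).2 ⟨hxn, hi⟩
    simp only [tripleUnion, Finset.mem_union]
    fin_cases i
    exacts [.inl hxi, .inr (.inl hxi), .inr (.inr hxi)]

end Graphs

theorem input_spec {n : ℕ} (G : SimpleGraph (Fin n)) :
    ∀ v < n, ∀ u < n,
      (if u = v then 1 else (input G).mem (v * n + u)) ≠ 0 ↔ ClosedAdj G v u := by
  intro v hv u hu
  have key : ∀ i j : Fin n, v * n + u = i * n + j ↔ v = i ∧ u = j := by
    intro i j
    constructor
    · intro h
      have hn : 0 < n := by lia
      have h1 : v = i := by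
        have := congrArg (· / n) h
        simpa [Nat.add_div_of_dvd_right, Nat.mul_div_cancel _ hn, Nat.div_eq_of_lt, hu, j.2]
          using this
      refine ⟨h1, ?_⟩
      rw [h1] at h
      lia
    · rintro ⟨h1, h2⟩
      rw [h1, h2]
  by_cases h : u = v
  · subst h
    simp only [↓reduceIte, ne_eq, one_ne_zero, not_false_eq_true, true_iff]
    exact ⟨⟨u, hu⟩, ⟨u, hu⟩, rfl, rfl, .inl rfl⟩
  · have hm : (input G).mem (v * n + u) ≠ 0 ↔
        ∃ i j : Fin n, v * n + u = i * n + j ∧ G.Adj i j := by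
      simp [input]
    rw [if_neg h, hm]
    refine exists_congr fun i => exists_congr fun j => ?_
    rw [key, and_assoc]
    refine and_congr_right fun h1 => and_congr_right fun h2 => (or_iff_right ?_).symm
    rintro rfl
    exact h (h2.trans h1.symm)

theorem input_bounded {n M : ℕ} (G : SimpleGraph (Fin n)) (hn : 0 < n) (hM : n ≤ M) :
    (input G).Bounded M := by
  constructor <;> intro k <;> simp only [input] <;> split_ifs <;> lia

theorem threeDomatic_exec {n : ℕ} (G : SimpleGraph (Fin n)) (hn : 0 < n) (ω : ℕ → Bool) :
    ∃ s t, Exec ω threeDomatic (input G) s t ∧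
      t ≤ 2 ^ n * ((16 * n ^ 2 + 70 * n + 56) * (32 * n ^ 2 + 3)) ∧
      (s.reg 0 ≠ 0 ↔ 3 ≤ domaticNumber G) := by
  have hM : n ≤ 2 ^ (16 * n ^ 2) := by
    refine Nat.lt_two_pow_self.le.trans (Nat.pow_le_pow_right (by simp) ?_)
    nlinarith
  obtain ⟨s, t, he, ht, -, hs⟩ := threeDomatic_spec (ω := ω) hn (by simp [input]) (input_spec G)
    (input_bounded G hn hM)
  refine ⟨s, t, he, ht.trans (le_of_eq ?_), ?_⟩
  -- The bound `2 ^ (16 * n ^ 2)` has `16 * n ^ 2 + 1` bits, so an instruction costs at most `32 * n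
  -- ^ 2 + 3`.
  · rw [Nat.size_pow]
    ring
  · rw [hs, hasTriple_iff, three_le_domaticNumber_iff]

/-! ### Comparison of $2^n$ with the required time bound. -/

theorem sum_choose_Icc_add_two {m : ℕ} (hm : 1 ≤ m) :
    ∑ b ∈ Finset.Icc 1 (m - 1), m.choose b + 2 = 2 ^ m := by
  obtain ⟨m, rfl⟩ := Nat.exists_eq_add_of_le' hm
  rw [← Nat.sum_range_choose, Finset.sum_range_succ, Finset.range_eq_Ico,
    Finset.sum_eq_sum_Ico_succ_bot (by simp), Nat.add_sub_cancel]
  simp only [Nat.choose_zero_right, Nat.choose_self]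
  rw [show Finset.Ico (0 + 1) (m + 1) = Finset.Icc 1 m from rfl]
  ring

/-- With $\Delta = k + 2$, the inner sum is $2^{\Delta-a} - 2$. Extending the outer sum to $a \le
\Delta$ gives $3^\Delta - 2\cdot 2^\Delta$; the added terms are $0$ for $a = \Delta - 1$ and $-1$
for $a = \Delta$. -/
theorem dConst_add (k : ℕ) : dConst (k + 2) + 2 * 2 ^ (k + 2) = 3 ^ (k + 2) + 1 := by
  have h1 : dConst (k + 2) + ∑ a ∈ Finset.range (k + 1), (k + 2).choose a * 2 =
      ∑ a ∈ Finset.range (k + 1), (k + 2).choose a * 2 ^ (k + 2 - a) := by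
    rw [dConst, Nat.add_sub_cancel, show Finset.Icc 0 k = Finset.range (k + 1) by ext; simp,
      ← Finset.sum_add_distrib]
    refine Finset.sum_congr rfl fun a ha => ?_
    rw [Finset.mem_range] at ha
    rw [← mul_add, sum_choose_Icc_add_two (by lia)]
  have h2 := Nat.sum_range_choose (k + 2)
  have h3 := add_pow 1 2 (k + 2)
  rw [Finset.sum_range_succ, Finset.sum_range_succ] at h2 h3
  have h4 : ∑ a ∈ Finset.range (k + 1), 1 ^ a * 2 ^ (k + 2 - a) * (k + 2).choose a =
      ∑ a ∈ Finset.range (k + 1), (k + 2).choose a * 2 ^ (k + 2 - a) :=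
    Finset.sum_congr rfl fun a _ => by ring
  have h5 : k + 2 - (k + 1) = 1 := by lia
  simp only [Nat.cast_id, h4, h5] at h3
  rw [← Finset.sum_mul] at h1
  simp only [Nat.choose_self, Nat.choose_succ_self_right, Nat.sub_self] at h2 h3
  norm_num at h3
  lia

theorem four_le_rConst {Δ : ℕ} (hΔ : 3 ≤ Δ) : 4 ≤ rConst Δ := by
  obtain ⟨k, rfl⟩ := Nat.exists_eq_add_of_le' hΔ
  -- By the closed form of $d$, this is $4\cdot 3^{\Delta-2} \le d$ with $\Delta - 2$ written as `k
  -- + 1`; equality holds at `k = 0`.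
  have h : ∀ k : ℕ, 8 * 2 ^ (k + 1) ≤ 5 * 3 ^ (k + 1) + 1 := by
    intro k
    induction k with
    | zero => norm_num
    | succ k ih =>
      have : 0 < 3 ^ (k + 1) := by positivity
      rw [pow_succ 2, pow_succ 3]
      lia
  have hd := dConst_add (k + 1)
  have hk := h k
  rw [pow_add 2 (k + 1) 2, pow_add 3 (k + 1) 2] at hd
  have key : 4 * 3 ^ (k + 1) ≤ dConst (k + 3) := by
    rw [show k + 1 + 2 = k + 3 from rfl] at hd
    lia
  rw [rConst, le_div_iff₀ (by positivity)]
  exact_mod_cast key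

theorem softO_two_pow (p : Polynomial ℝ) {Δ : ℕ} (hΔ : 3 ≤ Δ) :
    SoftO (fun n => p.eval (n : ℝ) * 2 ^ n) (fun n => rConst Δ ^ ((n : ℝ) / 2)) := by
  refine ⟨p, Asymptotics.IsBigO.mul (Asymptotics.isBigO_refl _ _)
    (Asymptotics.IsBigO.of_bound 1 (Filter.Eventually.of_forall fun n => ?_))⟩
  have h : (2 : ℝ) ^ n = 4 ^ ((n : ℝ) / 2) := by
    rw [show (4 : ℝ) = 2 ^ (2 : ℝ) by norm_num, ← Real.rpow_mul (by simp), ← Real.rpow_natCast]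
    congr 1
    ring
  have h' : (4 : ℝ) ^ ((n : ℝ) / 2) ≤ rConst Δ ^ ((n : ℝ) / 2) :=
    Real.rpow_le_rpow (by simp) (four_le_rConst hΔ) (by positivity)
  rw [h, one_mul, Real.norm_of_nonneg (by positivity)]
  exact h'.trans (le_abs_self _)

end Domatic

theorem theorem3 (c : ℝ) (hc : 0 < c) :
    ∃ A : Domatic.Prog, ∀ Δ : ℕ, 3 ≤ Δ →
      ∃ T : ℕ → ℝ, Domatic.SoftO T (fun n => Domatic.rConst Δ ^ ((n : ℝ) / 2)) ∧
        ∀ (n : ℕ) (G : SimpleGraph (Fin n)) [DecidableRel G.Adj], G.maxDegree = Δ →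
          (∀ ω : ℕ → Bool, Domatic.HaltsWithin A G ω (T n)) ∧
          Domatic.errorProb A G ≤ ENNReal.ofReal (Real.exp (-c)) := by
  open Polynomial in
  refine ⟨Domatic.threeDomatic, fun Δ hΔ => ⟨_, Domatic.softO_two_pow
    ((16 * X ^ 2 + 70 * X + 56) * (32 * X ^ 2 + 3)) hΔ, fun n G _ hG => ?_⟩⟩
  -- The empty graph has maximum degree 0, which `3 ≤ Δ` excludes.
  have hn : 0 < n := by
    rcases Nat.eq_zero_or_pos n with rfl | h
    · rw [SimpleGraph.maxDegree_of_subsingleton] at hG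
      lia
    · exact h
  refine ⟨fun ω => ?_, ?_⟩
  · obtain ⟨s, t, he, ht, -⟩ := Domatic.threeDomatic_exec G hn ω
    refine ⟨s, t, he, ?_⟩
    have ht' : (t : ℝ) ≤ 2 ^ n * ((16 * n ^ 2 + 70 * n + 56) * (32 * n ^ 2 + 3)) := by
      exact_mod_cast ht
    refine ht'.trans (le_of_eq ?_)
    simp
    ring
  -- The answer is right for every bit sequence, so the error probability is 0. Since acceptance
  -- only asks for some accepting run, uniqueness of runs is needed to identify it with the run
  -- constructed above.
  · have h : {ω | ¬ (Domatic.Accepts Domatic.threeDomatic G ω ↔ 3 ≤ Domatic.domaticNumber G)} =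
        ∅ := by
      refine Set.eq_empty_of_forall_notMem fun ω hω => hω ?_
      obtain ⟨s, t, he, -, hs⟩ := Domatic.threeDomatic_exec G hn ω
      rw [← hs]
      constructor
      · rintro ⟨s', t', he', h'⟩
        rwa [(he.unique he').1]
      · exact fun h' => ⟨s, t, he, h'⟩
    rw [Domatic.errorProb, h, MeasureTheory.measure_empty]
    exact zero_le
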